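/- Fix real numbers $\gamma_1>\gamma_2>0$ and $0<s<1/2$. For an integer $k$ (large enough that $p:=\gamma_1k^{-1/2}\le 1$), put $q:=\gamma_2k^{-1/2}$ and let $A=(a_{ij})\in\mathbb{R}^{2k\times 2k}$ be the random signed adjacency matrix of the signed stochastic bisection model $\mathsf{SignedBlock}_k(p,q,s)$ on the node set $[2k]$ with communities $[k]$ and $[2k]\setminus[k]$: $A$ is symmetric with zero diagonal, and for $i<j$, $a_{ij}=P_{ij}(1-2S_{ij})$, where all $P_{ij},S_{ij}$ are independent Bernoulli variables, $P_{ij}$ having mean $p$ and $S_{ij}$ mean $s$ if $i,j$ lie in the same community, and $P_{ij}$ having mean $q$ and $S_{ij}$ mean $1-s$ otherwise. Let $d_i=\sum_j|a_{ij}|$, $D=\mathrm{diag}(d_1,\dots,d_{2k})$, and let $\mathcal{L}=D^{-1/2}(D-A)D^{-1/2}$ be the normalized signed Laplacian, where $(D^{-1/2})_{ii}:=0$ if $d_i=0$. Let $\lambda_1(\mathcal{L})$ be the least eigenvalue of $\mathcal{L}$, and let $\bar u_1=\frac{1}{\sqrt{2k}}(\mathbf 1_k,-\mathbf 1_k)^T$.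 For $x\in\mathbb{R}$ let $\mathrm{sgn}(x)=1$ if $x\ge 0$ and $\mathrm{sgn}(x)=-1$ otherwise. Then there is a constant $C=C(\gamma_1,\gamma_2,s)>0$, not depending on $k$, such that for all sufficiently large $k$, with probability at least $1-k^{-2}$, the following hold simultaneously: the eigenvalue $\lambda_1(\mathcal{L})$ is simple; a unit eigenvector $u_1$ of $\mathcal{L}$ for $\lambda_1(\mathcal{L})$ is unique up to sign; and for every such $u_1$ there is a sign $\tau\in\{\pm1\}$ with $$\|\tau u_1-\bar u_1\|_2\le C k^{-1/4}\qquad\text{and}\qquad \#\{i\in[2k]:\mathrm{sgn}(\tau u_1(i))\ne\mathrm{sgn}(\bar u_1(i))\}\le C k^{1/2}.$$ Hence $\mathrm{sgn}(u_1)$ is weakly consistent: for every $\varepsilon>0$, the probability that for every unit eigenvector $u_1$ of $\mathcal{L}$ for $\lambda_1(\mathcal{L})$ there is a sign $\tau\in\{\pm1\}$ with $$\frac{1}{2k}\,\#\{i\in[2k]:\mathrm{sgn}(\tau u_1(i))\ne\mathrm{sgn}(\bar u_1(i))\}\le\varepsilon$$ tends to $1$ as $k\to\infty$. -/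

import Mathlib

open MeasureTheory ProbabilityTheory Filter Topology

namespace SignedSBM

/-! ### Random signed graphs on `[n]` -/

/-- Unordered pairs `{i, j}` of distinct nodes of `[n]`, represented by the pair with `i < j`. -/
abbrev NodePair (n : ℕ) : Type := {e : Fin n × Fin n // e.1 < e.2}

/-- Outcomes of the coins of all node pairs: for each pair, the first coin says whether the edge is
present, the second one whether its sign is negative (it has no effect when the edge is absent). -/
abbrev Coins (n : ℕ) : Type := NodePair n → Bool × Bool

/-- The entry `a = P (1 - 2 S)` for the outcome `(P, S)` of the coins of a pair: it is `0` without
an edge, `1` for a positive edge and `-1` for a negative edge. -/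
def entry (x : Bool × Bool) : ℝ :=
  (if x.1 then 1 else 0) * (1 - 2 * (if x.2 then 1 else 0))

/-- The signed adjacency matrix: symmetric, with zero diagonal. -/
def adjacency {n : ℕ} (ω : Coins n) : Matrix (Fin n) (Fin n) ℝ :=
  Matrix.of fun i j =>
    if h : i < j then entry (ω ⟨(i, j), h⟩)
    else if h : j < i then entry (ω ⟨(j, i), h⟩)
    else 0

/-- The signed inhomogeneous Erdős–Rényi model `G_n(P, S)`: independently over all node pairs
`{i, j}`, an edge is added with probability `P i j`, and, independently, a negative sign with
probability `S i j`. -/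
noncomputable def signedER {n : ℕ} (P S : Matrix (Fin n) (Fin n) unitInterval) :
    Measure (Coins n) :=
  Measure.pi fun e : NodePair n =>
    (bernoulliMeasure true false (P e.1.1 e.1.2)).prod
      (bernoulliMeasure true false (S e.1.1 e.1.2))

/-- Extension of an `m × m` matrix of block probabilities to an `n × n` matrix with zero diagonal,
where `c i` is the block of node `i`. -/
def blockExtend {n m : ℕ} (c : Fin n → Fin m) (Q : Matrix (Fin m) (Fin m) unitInterval) :
    Matrix (Fin n) (Fin n) unitInterval :=
  Matrix.of fun i j => if i = j then 0 else Q (c i) (c j)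

/-- The bipartition `[2k] = [k] ⊔ ([2k] \ [k])`. -/
def community (k : ℕ) (i : Fin (2 * k)) : Fin 2 := if (i : ℕ) < k then 0 else 1

/-- The signed stochastic bisection model `SignedBlock_k(p, q, s)`. -/
noncomputable def signedBlock (k : ℕ) (p q s : unitInterval) : Measure (Coins (2 * k)) :=
  signedER (blockExtend (community k) !![p, q; q, p])
    (blockExtend (community k) !![s, unitInterval.symm s; unitInterval.symm s, s])

/-- A real number as a probability: numbers in `[0, 1]` are kept, others are sent to the nearest
endpoint. -/
noncomputable def prob (x : ℝ) : unitInterval := Set.projIcc (0 : ℝ) 1 zero_le_one x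

theorem coe_prob {x : ℝ} (h0 : 0 ≤ x) (h1 : x ≤ 1) : (prob x : ℝ) = x := by
  simp [prob, Set.projIcc_of_mem zero_le_one (show x ∈ Set.Icc (0 : ℝ) 1 from ⟨h0, h1⟩)]

/-- The dense setting `SignedBlock_k(γ₁ k^{-1/2}, γ₂ k^{-1/2}, s)`. The edge probabilities are not
changed by `prob` as soon as `k ≥ γ₁ ^ 2` and `k ≥ γ₂ ^ 2`. -/
noncomputable def denseBlock (γ₁ γ₂ s : ℝ) (k : ℕ) : Measure (Coins (2 * k)) :=
  signedBlock k (prob (γ₁ * (k : ℝ) ^ (-(1 / 2) : ℝ))) (prob (γ₂ * (k : ℝ) ^ (-(1 / 2) : ℝ)))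
    (prob s)

/-! ### The normalized signed Laplacian and its first eigenvector -/

/-- The degree of node `i`; the entries of a signed adjacency matrix `A` are `0, 1, -1`. -/
def degree {n : ℕ} (A : Matrix (Fin n) (Fin n) ℝ) (i : Fin n) : ℝ := ∑ j, |A i j|

/-- `D^{-1/2}`, whose entry at a node of degree `0` is `0`. -/
noncomputable def invSqrtDegree {n : ℕ} (A : Matrix (Fin n) (Fin n) ℝ) :
    Matrix (Fin n) (Fin n) ℝ :=
  Matrix.diagonal fun i => (√(degree A i))⁻¹

/-- The normalized signed Laplacian `D^{-1/2} (D - A) D^{-1/2}`. -/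
noncomputable def normLaplacian {n : ℕ} (A : Matrix (Fin n) (Fin n) ℝ) :
    Matrix (Fin n) (Fin n) ℝ :=
  invSqrtDegree A * (Matrix.diagonal (degree A) - A) * invSqrtDegree A

/-- `λ₁(X)`, the least eigenvalue of a real symmetric matrix `X` (of size at least `1`; the set of
eigenvalues is then finite and nonempty). -/
noncomputable def lambdaOne {n : ℕ} (X : Matrix (Fin n) (Fin n) ℝ) : ℝ :=
  sInf {μ : ℝ | Module.End.HasEigenvalue (Matrix.toEuclideanLin X) μ}

/-- `λ₁(X)` is a simple eigenvalue of the symmetric matrix `X`: its eigenspace is a line. -/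
def LambdaOneSimple {n : ℕ} (X : Matrix (Fin n) (Fin n) ℝ) : Prop :=
  Module.finrank ℝ (Module.End.eigenspace (Matrix.toEuclideanLin X) (lambdaOne X)) = 1

/-- `u` is an eigenvector of `X` for `λ₁(X)` with unit Euclidean norm. -/
def IsUnitEigenvectorOne {n : ℕ} (X : Matrix (Fin n) (Fin n) ℝ) (u : EuclideanSpace ℝ (Fin n)) :
    Prop :=
  Module.End.HasEigenvector (Matrix.toEuclideanLin X) (lambdaOne X) u ∧ ‖u‖ = 1

/-- `ū₁ = (1_k, -1_k) / √(2k)`. -/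
noncomputable def uBar (k : ℕ) : EuclideanSpace ℝ (Fin (2 * k)) :=
  WithLp.toLp 2 fun i => (if (i : ℕ) < k then 1 else -1) / √(2 * (k : ℝ))

/-- The sign of a real number, with `sgn 0 = 1`. -/
noncomputable def sgn (x : ℝ) : ℤ := if 0 ≤ x then 1 else -1

/-- The number of nodes `i` that are misclassified by `sgn v`, i.e. with
`sgn (v i) ≠ sgn (ū₁ i)`. -/
noncomputable def misclassified (k : ℕ) (v : EuclideanSpace ℝ (Fin (2 * k))) : ℕ :=
  {i : Fin (2 * k) | sgn (v i) ≠ sgn (uBar k i)}.ncard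

end SignedSBM

open SignedSBM

namespace SignedSBM

/-! ### Closed walks -/

/-! Let `σ = ±1` indicate the communities. Off the diagonal, the mean of `A` is `(1-2s)((p+q)/2 ·
σσᵀ + (p-q)/2 · 11ᵀ)`, and every expected degree is `d = k(p+q) - p`. With `A` and the degrees
replaced by their means, `1 - 𝓛 = D^{-1/2} A D^{-1/2}` has top eigenvector `ū₁` with eigenvalue
about `1-2s`. The next eigenvalue is about `(1-2s)κ`, where `κ = (γ₁-γ₂)/(γ₁+γ₂) < 1`, so the gap is
of constant order.

With high probability the deviations of `A` and `|A|` from their means have operator norm at most `E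
= O(√(kp)) = O(k^{1/4})`, while `d` has order `k^{1/2}`. The relative error `E/d` is thus
`O(k^{-1/4})`. A Davis–Kahan type argument (`first_eigenvector_perturbation`) turns it into the
eigenvector bound, and squaring gives `O(k^{1/2})` wrong signs (`misclassified_le`).

The norm bound must carry no logarithm (`norm_pairMatrix_tail`). A high moment of the norm is at
most a trace moment, which is a sum over closed walks. Only walks using every edge at least twice
survive, and one with `v` vertices contributes at most `p^(v-1)`. Grouping walks by their kernel
(`sum_doubled_le`) compares this sum with the plain count of such walks on `r` vertices, with `r` of
order `np`. That count is at most a trace moment of a dense `r × r` reference matrix, whose norm is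
`O(√r)` by a net argument. Moments of order `np` are allowed, so Markov's inequality gives a failure
probability exponentially small in `np`, which is of order `√k`.

Normalization also needs care (`normalized_form_bounds`). Uniformly in the nodes, the degrees are
only controlled up to a fixed fraction `η` of `d`. This suffices for the gap but not for the rate.
The residual is instead controlled by `∑ (dᵢ - d)² ≤ nE²`, obtained by applying the deviation of
`|A|` to the all-ones vector (`sum_sq_rowSum_le`). -/

theorem pow_apply_eq_sum_walks {ι : Type*} [Fintype ι] [DecidableEq ι] (M : Matrix ι ι ℝ) (L : ℕ)
    (i j : ι) :
    (M ^ L) i j = ∑ u : Fin (L + 1) → ι, if u 0 = i ∧ u (Fin.last L) = j then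
      ∏ t : Fin L, M (u t.castSucc) (u t.succ) else 0 := by
  induction L generalizing i with
  | zero =>
    rw [← (Equiv.funUnique (Fin 1) ι).symm.sum_comp]
    simp only [pow_zero, Matrix.one_apply, Finset.univ_eq_empty, Finset.prod_empty]
    by_cases h : i = j
    · subst h; simp
    · rw [if_neg h, Finset.sum_eq_zero]
      intro x _
      rw [if_neg]
      rintro ⟨rfl, h2⟩
      exact h h2
  | succ L ih =>
    rw [pow_succ', Matrix.mul_apply, ← (Fin.consEquiv fun _ : Fin (L + 2) => ι).sum_comp,
      Fintype.sum_prod_type]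
    simp only [Fin.consEquiv_apply, Fin.cons_zero, Fin.prod_univ_succ]
    symm
    rw [Finset.sum_eq_single i]
    · simp only [ih, Finset.mul_sum]
      rw [Finset.sum_comm]
      refine Finset.sum_congr rfl fun u _ => ?_
      symm
      rw [Finset.sum_eq_single (u 0)]
      · have : (Fin.cons i u : Fin (L + 2) → ι) (Fin.last (L + 1)) = u (Fin.last L) := by
          rw [← Fin.succ_last, Fin.cons_succ]
        simp only [this, true_and, Fin.castSucc_zero, Fin.cons_zero, Fin.cons_succ,
          ← Fin.succ_castSucc, mul_ite, mul_zero]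
      · intro x _ hx
        rw [if_neg (fun h => hx h.1.symm), mul_zero]
      · simp
    · intro x _ hx
      exact Finset.sum_eq_zero fun u _ => if_neg fun h => hx h.1
    · simp

theorem trace_pow_eq_sum_walks {ι : Type*} [Fintype ι] [DecidableEq ι] (M : Matrix ι ι ℝ)
    (L : ℕ) :
    (M ^ L).trace = ∑ u : Fin (L + 1) → ι, if u 0 = u (Fin.last L) then
      ∏ t : Fin L, M (u t.castSucc) (u t.succ) else 0 := by
  simp only [Matrix.trace, Matrix.diag, pow_apply_eq_sum_walks]
  rw [Finset.sum_comm]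
  refine Finset.sum_congr rfl fun u _ => ?_
  rw [Finset.sum_eq_single (u 0)]
  · simp [eq_comm]
  · intro x _ hx
    exact if_neg fun h => hx h.1.symm
  · simp

/-- A walk visits at most one vertex more than it has distinct edges. -/
theorem card_vertices_le_card_edges {V E : Type*} [DecidableEq V] [DecidableEq E] :
    ∀ (L : ℕ) (u : Fin (L + 1) → V) (g : Fin L → E),
      (∀ t t', g t = g t' → u t.succ = u t'.castSucc ∨ u t.succ = u t'.succ) →
      (Finset.univ.image u).card ≤ (Finset.univ.image g).card + 1
  | 0, u, g, _ => by
    refine Finset.card_image_le.trans ?_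
    simp
  | L + 1, u, g, h => by
    have ih := card_vertices_le_card_edges L (fun t => u t.castSucc) (fun t => g t.castSucc)
      fun t t' htt => by simpa using h _ _ htt
    have hu : (Finset.univ.image u) ⊆
        insert (u (Fin.last _)) (Finset.univ.image fun t : Fin (L + 1) => u t.castSucc) := by
      intro x hx
      obtain ⟨t, -, rfl⟩ := Finset.mem_image.1 hx
      refine Fin.lastCases ?_ (fun t => ?_) t
      · exact Finset.mem_insert_self _ _
      · exact Finset.mem_insert_of_mem (Finset.mem_image_of_mem _ (Finset.mem_univ _))
    have hg : (Finset.univ.image fun t : Fin L => g t.castSucc) ⊆ Finset.univ.image g := by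
      intro x hx
      obtain ⟨t, -, rfl⟩ := Finset.mem_image.1 hx
      exact Finset.mem_image_of_mem _ (Finset.mem_univ _)
    by_cases hlast : u (Fin.last _) ∈ Finset.univ.image fun t : Fin (L + 1) => u t.castSucc
    · rw [Finset.insert_eq_of_mem hlast] at hu
      exact (Finset.card_le_card hu).trans (ih.trans (by gcongr))
    · have hgl : g (Fin.last L) ∉ Finset.univ.image fun t : Fin L => g t.castSucc := by
        intro hmem
        obtain ⟨t, -, ht⟩ := Finset.mem_image.1 hmem
        apply hlast
        rcases h (Fin.last L) t.castSucc ht.symm with h1 | h1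
        · rw [Fin.succ_last] at h1
          rw [h1]
          exact Finset.mem_image_of_mem _ (Finset.mem_univ _)
        · rw [Fin.succ_last, Fin.succ_castSucc] at h1
          rw [h1]
          exact Finset.mem_image_of_mem (fun t : Fin (L + 1) => u t.castSucc) (Finset.mem_univ _)
      have hlt : (Finset.univ.image fun t : Fin L => g t.castSucc).card + 1 ≤
          (Finset.univ.image g).card := by
        rw [← Finset.card_insert_of_notMem hgl]
        refine Finset.card_le_card (Finset.insert_subset ?_ hg)
        exact Finset.mem_image_of_mem _ (Finset.mem_univ _)
      have := (Finset.card_le_card hu).trans (Finset.card_insert_le _ _)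
      omega

/-- The closed walks without loops which traverse every edge at least twice. The condition is
stated in terms of the kernel of the walk only. -/
def IsDoubled {L : ℕ} {V : Type*} (u : Fin (L + 1) → V) : Prop :=
  u 0 = u (Fin.last L) ∧ (∀ t : Fin L, u t.castSucc ≠ u t.succ) ∧
    ∀ t : Fin L, ∃ t' : Fin L, t' ≠ t ∧
      ((u t'.castSucc = u t.castSucc ∧ u t'.succ = u t.succ) ∨
        (u t'.castSucc = u t.succ ∧ u t'.succ = u t.castSucc))

/-- Only coincidences between positions matter, so the property can be transported between walks on
vertex sets of different sizes. -/
theorem isDoubled_congr {L : ℕ} {V W : Type*} {u : Fin (L + 1) → V} {v : Fin (L + 1) → W}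
    (h : ∀ a b, u a = u b ↔ v a = v b) : IsDoubled u ↔ IsDoubled v := by
  simp only [IsDoubled, ne_eq, h]

-- A map with kernel `S` is the same as an injection of the quotient by `S`, so the count depends on
-- `S` only through its number of classes.
open Classical in
theorem card_ker_eq {A : Type*} [Fintype A] (S : Setoid A) (N : ℕ) :
    (Finset.univ.filter fun u : A → Fin N => Setoid.ker u = S).card =
      N.descFactorial (Fintype.card (Quotient S)) := by
  rw [← Fintype.card_subtype, ← Fintype.card_fin N, ← Fintype.card_embedding_eq,
    Fintype.card_fin]
  symm
  refine Fintype.card_of_bijective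
    (f := fun φ : Quotient S ↪ Fin N => (⟨fun a => φ ⟦a⟧, ?_⟩ : {u : A → Fin N // Setoid.ker u = S}))
    ⟨?_, ?_⟩
  · ext a b
    simp only [Setoid.ker_def, φ.injective.eq_iff, Quotient.eq]
  · intro φ ψ h
    ext x
    obtain ⟨a, rfl⟩ := Quotient.exists_rep x
    have := congrFun (congrArg Subtype.val h) a
    exact congrArg Fin.val this
  · rintro ⟨u, rfl⟩
    refine ⟨⟨Quotient.lift u fun a b h => h, ?_⟩, ?_⟩
    · intro x y
      obtain ⟨a, rfl⟩ := Quotient.exists_rep x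
      obtain ⟨b, rfl⟩ := Quotient.exists_rep y
      intro h
      exact Quotient.sound h
    · rfl

open Classical in
theorem card_image_eq_card_quotient_ker {A V : Type*} [Fintype A] [DecidableEq V]
    (u : A → V) :
    (Finset.univ.image u).card = Fintype.card (Quotient (Setoid.ker u)) := by
  rw [Fintype.card_congr (Setoid.quotientKerEquivRange u), ← Set.toFinset_card, Set.toFinset_range]

open Classical in
/-- Comparison of weighted doubled walks on `n` vertices with doubled walks on `r` vertices. -/
theorem sum_doubled_le {n r L : ℕ} {p : ℝ} (hp : 0 < p) (h : n * p + L ≤ r) :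
    ∑ u : Fin (L + 1) → Fin n, (if IsDoubled u then p ^ ((Finset.univ.image u).card - 1) else 0) ≤
      p⁻¹ * ∑ u : Fin (L + 1) → Fin r, if IsDoubled u then 1 else 0 := by
  have : Fintype (Setoid (Fin (L + 1))) := by
    have : Finite (Setoid (Fin (L + 1))) :=
      Finite.of_injective (fun S : Setoid (Fin (L + 1)) => S.r) fun S T h => by
        cases S; cases T; simp at h; subst h; rfl
    exact Fintype.ofFinite _
  -- Both sums are split by kernel. Within one class, being doubled and the number `c` of visited
  -- vertices are constant, so only falling factorials need comparing.
  rw [← Finset.sum_fiberwise Finset.univ (fun u : Fin (L + 1) → Fin n => Setoid.ker u),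
    ← Finset.sum_fiberwise Finset.univ (fun u : Fin (L + 1) → Fin r => Setoid.ker u),
    Finset.mul_sum]
  refine Finset.sum_le_sum fun S _ => ?_
  have hker : ∀ {N : ℕ} (u : Fin (L + 1) → Fin N), Setoid.ker u = S →
      (IsDoubled u ↔ IsDoubled (fun a => (⟦a⟧ : Quotient S))) := by
    rintro N u rfl
    refine isDoubled_congr fun a b => ?_
    rw [Quotient.eq, Setoid.ker_def]
  set c := Fintype.card (Quotient S) with hc
  have hc1 : 1 ≤ c := Fintype.card_pos_iff.2 ⟨⟦0⟧⟩
  have hcL : c ≤ L + 1 := (Fintype.card_quotient_le S).trans (by simp)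
  by_cases hS : IsDoubled (fun a => (⟦a⟧ : Quotient S))
  · have e1 : ∑ u : Fin (L + 1) → Fin n with Setoid.ker u = S,
        (if IsDoubled u then p ^ ((Finset.univ.image u).card - 1) else 0) =
        n.descFactorial c * p ^ (c - 1) := by
      rw [← card_ker_eq, ← nsmul_eq_mul, ← Finset.sum_const]
      refine Finset.sum_congr (by ext; simp) fun u hu => ?_
      have hu := (Finset.mem_filter.1 hu).2
      rw [if_pos ((hker u hu).2 hS), card_image_eq_card_quotient_ker]
      subst hu
      rw [hc]
      congr!
    have e2 : ∑ u : Fin (L + 1) → Fin r with Setoid.ker u = S,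
        (if IsDoubled u then (1 : ℝ) else 0) = r.descFactorial c := by
      rw [← card_ker_eq, ← nsmul_one, ← Finset.sum_const]
      refine Finset.sum_congr (by ext; simp) fun u hu => ?_
      rw [if_pos ((hker u (Finset.mem_filter.1 hu).2).2 hS)]
    rw [e1, e2]
    have h1 : (n.descFactorial c : ℝ) ≤ (n : ℝ) ^ c := by
      exact_mod_cast Nat.descFactorial_le_pow n c
    have hrL : (L : ℝ) ≤ r := le_trans (by have : 0 ≤ n * p := by positivity
                                           linarith) h
    have hrL' : L ≤ r := by exact_mod_cast hrL
    have h2 : ((r : ℝ) - L) ^ c ≤ (r.descFactorial c : ℝ) := by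
      have := Nat.pow_sub_le_descFactorial r c
      have h3 : (r - L) ^ c ≤ (r + 1 - c) ^ c := Nat.pow_le_pow_left (by omega) c
      have h4 := h3.trans this
      rw [← Nat.cast_sub hrL']
      exact_mod_cast h4
    have h5 : ((n : ℝ) * p) ^ c ≤ (r - L) ^ c := by
      gcongr
      linarith
    obtain ⟨c', hc'⟩ : ∃ c', c = c' + 1 := ⟨c - 1, by omega⟩
    have h6 : p ^ (c - 1) = p⁻¹ * p ^ c := by
      rw [hc', Nat.add_sub_cancel, pow_succ]; field_simp
    calc (n.descFactorial c : ℝ) * p ^ (c - 1) ≤ (n : ℝ) ^ c * p ^ (c - 1) := by gcongr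
      _ = p⁻¹ * ((n : ℝ) * p) ^ c := by rw [h6, mul_pow]; ring
      _ ≤ p⁻¹ * r.descFactorial c := by gcongr; exact h5.trans h2
  · have e1 : ∑ u : Fin (L + 1) → Fin n with Setoid.ker u = S,
        (if IsDoubled u then p ^ ((Finset.univ.image u).card - 1) else 0) = 0 := by
      refine Finset.sum_eq_zero fun u hu => ?_
      rw [if_neg fun h => hS ((hker u (Finset.mem_filter.1 hu).2).1 h)]
    rw [e1]
    refine mul_nonneg (by positivity) (Finset.sum_nonneg fun u _ => ?_)
    split_ifs <;> simp

/-! ### Moments of random symmetric matrices with independent entries -/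

/-- The symmetric matrix with zero diagonal and given entries at the node pairs. -/
def pairMatrix {n : ℕ} (x : NodePair n → ℝ) : Matrix (Fin n) (Fin n) ℝ :=
  Matrix.of fun i j =>
    if h : i < j then x ⟨(i, j), h⟩
    else if h : j < i then x ⟨(j, i), h⟩
    else 0

def pairOf {n : ℕ} (i j : Fin n) (h : i ≠ j) : NodePair n :=
  if hij : i < j then ⟨(i, j), hij⟩ else ⟨(j, i), lt_of_le_of_ne (not_lt.1 hij) h.symm⟩

theorem pairMatrix_self {n : ℕ} (x : NodePair n → ℝ) (i : Fin n) : pairMatrix x i i = 0 := by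
  simp [pairMatrix]

theorem pairMatrix_of_ne {n : ℕ} (x : NodePair n → ℝ) {i j : Fin n} (h : i ≠ j) :
    pairMatrix x i j = x (pairOf i j h) := by
  rcases lt_or_gt_of_ne h with hij | hij
  · simp [pairMatrix, pairOf, hij]
  · simp [pairMatrix, pairOf, hij, hij.not_gt]

theorem pairMatrix_comm {n : ℕ} (x : NodePair n → ℝ) (i j : Fin n) :
    pairMatrix x i j = pairMatrix x j i := by
  rcases lt_trichotomy i j with hij | hij | hij
  · simp [pairMatrix, hij, hij.not_gt]
  · rw [hij]
  · simp [pairMatrix, hij, hij.not_gt]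

theorem pairOf_eq_pairOf_iff {n : ℕ} {i j i' j' : Fin n} (h : i ≠ j) (h' : i' ≠ j') :
    pairOf i' j' h' = pairOf i j h ↔ (i' = i ∧ j' = j) ∨ (i' = j ∧ j' = i) := by
  simp only [pairOf]
  split_ifs <;> simp only [Subtype.mk.injEq, Prod.mk.injEq] <;> grind

/-- Independence: the steps are regrouped by edge, and each edge contributes a moment of order equal
to its multiplicity in the walk. -/
theorem integral_prod_walk {n : ℕ} {α : Type*} [MeasurableSpace α]
    (ν : NodePair n → Measure α) [∀ e, IsProbabilityMeasure (ν e)] (ξ : NodePair n → α → ℝ)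
    {L : ℕ} (u : Fin (L + 1) → Fin n)
    (hu : ∀ t : Fin L, u t.castSucc ≠ u t.succ) :
    ∫ ω, ∏ t : Fin L, pairMatrix (fun e => ξ e (ω e)) (u t.castSucc) (u t.succ) ∂Measure.pi ν =
      ∏ e, ∫ x, ξ e x ^ (Finset.univ.filter fun t => pairOf _ _ (hu t) = e).card ∂ν e := by
  rw [← integral_fintype_prod_eq_prod]
  refine integral_congr_ae (ae_of_all _ fun ω => ?_)
  simp only [pairMatrix_of_ne _ (hu _)]
  rw [← Finset.prod_fiberwise Finset.univ fun t => pairOf _ _ (hu t)]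
  refine Finset.prod_congr rfl fun e _ => ?_
  rw [← Finset.prod_const]
  refine Finset.prod_congr rfl fun t ht => ?_
  rw [(Finset.mem_filter.1 ht).2]

section

variable {n : ℕ} {α : Type*} [Finite α] [MeasurableSpace α] [MeasurableSingletonClass α]
  (ν : NodePair n → Measure α) [∀ e, IsProbabilityMeasure (ν e)] (ξ : NodePair n → α → ℝ)

theorem integral_trace_pow (L : ℕ) :
    ∫ ω, ((pairMatrix fun e => ξ e (ω e)) ^ L).trace ∂Measure.pi ν =
      ∑ u : Fin (L + 1) → Fin n, if u 0 = u (Fin.last L) then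
        ∫ ω, ∏ t : Fin L, pairMatrix (fun e => ξ e (ω e)) (u t.castSucc) (u t.succ) ∂Measure.pi ν
      else 0 := by
  simp only [trace_pow_eq_sum_walks]
  rw [integral_finsetSum _ fun _ _ => Integrable.of_finite]
  refine Finset.sum_congr rfl fun u _ => ?_
  split_ifs <;> simp

theorem prod_walk_eq_zero {L : ℕ} (x : NodePair n → ℝ) (u : Fin (L + 1) → Fin n)
    (hu : ¬ ∀ t : Fin L, u t.castSucc ≠ u t.succ) :
    ∏ t : Fin L, pairMatrix x (u t.castSucc) (u t.succ) = 0 := by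
  push Not at hu
  obtain ⟨t, ht⟩ := hu
  refine Finset.prod_eq_zero (Finset.mem_univ t) ?_
  rw [ht, pairMatrix_self]

/-- Translates the kernel condition into multiplicities: no edge is used exactly once, while unused
edges are allowed. -/
theorem isDoubled_iff {L : ℕ} {u : Fin (L + 1) → Fin n} (h0 : u 0 = u (Fin.last L))
    (hu : ∀ t : Fin L, u t.castSucc ≠ u t.succ) :
    IsDoubled u ↔ ∀ e, (Finset.univ.filter fun t => pairOf _ _ (hu t) = e).card ≠ 1 := by
  simp only [IsDoubled, h0, true_and]
  constructor
  · rintro ⟨-, h⟩ e he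
    obtain ⟨t, ht⟩ := Finset.card_eq_one.1 he
    have h1 : pairOf _ _ (hu t) = e := by
      have : t ∈ Finset.univ.filter fun t => pairOf _ _ (hu t) = e := by rw [ht]; simp
      exact (Finset.mem_filter.1 this).2
    obtain ⟨t', hne, h2⟩ := h t
    have : t' ∈ Finset.univ.filter fun t => pairOf _ _ (hu t) = e := by
      refine Finset.mem_filter.2 ⟨Finset.mem_univ _, ?_⟩
      rw [← h1]
      exact (pairOf_eq_pairOf_iff _ _).2 h2
    rw [ht, Finset.mem_singleton] at this
    exact hne this
  · intro h
    refine ⟨hu, fun t => ?_⟩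
    by_contra hcon
    push Not at hcon
    refine h (pairOf _ _ (hu t)) (Finset.card_eq_one.2 ⟨t, ?_⟩)
    ext t'
    simp only [Finset.mem_filter, Finset.mem_univ, true_and, Finset.mem_singleton]
    constructor
    · intro h'
      by_contra hne
      rcases (pairOf_eq_pairOf_iff _ _).1 h' with h2 | h2
      · exact (hcon t' hne).1 h2.1 h2.2
      · exact (hcon t' hne).2 h2.1 h2.2
    · rintro rfl
      rfl

-- Centering kills walks with an edge of multiplicity one. Entries bounded by `1` have all higher
-- moments at most the variance bound `p`, so a surviving walk gains one factor `p` per distinct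
-- edge.
open Classical in
theorem integral_trace_pow_le {p : ℝ} (hp0 : 0 ≤ p) (hp1 : p ≤ 1) (h1 : ∀ e x, |ξ e x| ≤ 1)
    (hmean : ∀ e, ∫ x, ξ e x ∂ν e = 0) (hvar : ∀ e, ∫ x, ξ e x ^ 2 ∂ν e ≤ p) (L : ℕ) :
    ∫ ω, ((pairMatrix fun e => ξ e (ω e)) ^ L).trace ∂Measure.pi ν ≤
      ∑ u : Fin (L + 1) → Fin n,
        if IsDoubled u then p ^ ((Finset.univ.image u).card - 1) else 0 := by
  have hmom : ∀ e c, 2 ≤ c → |∫ x, ξ e x ^ c ∂ν e| ≤ p := by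
    intro e c hc
    refine le_trans (abs_integral_le_integral_abs) (le_trans ?_ (hvar e))
    refine integral_mono Integrable.of_finite Integrable.of_finite fun x => ?_
    simp only [abs_pow]
    rw [← sq_abs (ξ e x)]
    exact pow_le_pow_of_le_one (abs_nonneg _) (h1 e x) hc
  rw [integral_trace_pow]
  refine Finset.sum_le_sum fun u _ => ?_
  have hnn : 0 ≤ if IsDoubled u then p ^ ((Finset.univ.image u).card - 1) else 0 := by
    split_ifs <;> positivity
  by_cases h0 : u 0 = u (Fin.last L)
  swap
  · rwa [if_neg h0]
  rw [if_pos h0]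
  by_cases hu : ∀ t : Fin L, u t.castSucc ≠ u t.succ
  swap
  · simp only [prod_walk_eq_zero _ u hu, integral_zero]
    exact hnn
  rw [integral_prod_walk ν ξ u hu]
  by_cases hd : IsDoubled u
  · rw [if_pos hd]
    have hd' := (isDoubled_iff h0 hu).1 hd
    refine (le_abs_self _).trans ?_
    rw [Finset.abs_prod]
    set T := Finset.univ.image fun t => pairOf _ _ (hu t) with hT
    have hle : ∏ e, |∫ x, ξ e x ^ (Finset.univ.filter fun t => pairOf _ _ (hu t) = e).card ∂ν e| ≤
        ∏ e, if e ∈ T then p else 1 := by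
      refine Finset.prod_le_prod (fun _ _ => abs_nonneg _) fun e _ => ?_
      split_ifs with he
      · refine hmom e _ ?_
        have : (Finset.univ.filter fun t => pairOf _ _ (hu t) = e).card ≠ 0 := by
          obtain ⟨t, -, ht⟩ := Finset.mem_image.1 he
          exact Finset.card_ne_zero_of_mem (Finset.mem_filter.2 ⟨Finset.mem_univ t, ht⟩)
        have := hd' e
        omega
      · rw [Finset.filter_eq_empty_iff.2, Finset.card_empty]
        · simp
        · intro t _ ht
          exact he (Finset.mem_image.2 ⟨t, Finset.mem_univ _, ht⟩)
    refine hle.trans ?_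
    rw [Finset.prod_ite_mem, Finset.univ_inter, Finset.prod_const]
    -- As `p ≤ 1`, the number of distinct edges may be replaced by its lower bound, the number of
    -- vertices minus one.
    refine pow_le_pow_of_le_one hp0 hp1 ?_
    have := card_vertices_le_card_edges L u (fun t => pairOf _ _ (hu t)) ?_
    · rw [← hT] at this
      omega
    · intro t t' h
      rcases (pairOf_eq_pairOf_iff _ _).1 h with h | h
      · exact Or.inr h.2
      · exact Or.inl h.2
  · rw [if_neg hd]
    rw [isDoubled_iff h0 hu] at hd
    push Not at hd
    obtain ⟨e, he⟩ := hd
    refine (Finset.prod_eq_zero (Finset.mem_univ e) ?_).le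
    rw [he]
    simpa using hmean e

-- The converse comparison: if all moments of order at least two are at least `1`, every doubled
-- walk contributes at least `1` and no other walk contributes negatively.
open Classical in
theorem le_integral_trace_pow (hmean : ∀ e, ∫ x, ξ e x ∂ν e = 0)
    (hmom : ∀ e c, 2 ≤ c → 1 ≤ ∫ x, ξ e x ^ c ∂ν e) (L : ℕ) :
    ∑ u : Fin (L + 1) → Fin n, (if IsDoubled u then (1 : ℝ) else 0) ≤
      ∫ ω, ((pairMatrix fun e => ξ e (ω e)) ^ L).trace ∂Measure.pi ν := by
  rw [integral_trace_pow]
  refine Finset.sum_le_sum fun u _ => ?_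
  by_cases h0 : u 0 = u (Fin.last L)
  swap
  · rw [if_neg h0, if_neg fun h => h0 h.1]
  rw [if_pos h0]
  by_cases hu : ∀ t : Fin L, u t.castSucc ≠ u t.succ
  swap
  · simp only [prod_walk_eq_zero _ u hu, integral_zero]
    rw [if_neg fun h => hu h.2.1]
  rw [integral_prod_walk ν ξ u hu]
  have hge : ∀ e c, c ≠ 1 → 1 ≤ ∫ x, ξ e x ^ c ∂ν e := by
    intro e c hc
    rcases Nat.lt_or_ge c 2 with h | h
    · have : c = 0 := by omega
      simp [this]
    · exact hmom e c h
  split_ifs with hd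
  · have hd' := (isDoubled_iff h0 hu).1 hd
    rw [← Finset.prod_const_one (s := (Finset.univ : Finset (NodePair n)))]
    exact Finset.prod_le_prod (fun _ _ => zero_le_one) fun e _ => hge e _ (hd' e)
  · refine Finset.prod_nonneg fun e _ => ?_
    by_cases hc : (Finset.univ.filter fun t => pairOf _ _ (hu t) = e).card = 1
    · rw [hc]
      simp [hmean e]
    · exact zero_le_one.trans (hge e _ hc)

end

/-! ### The operator norm of a matrix -/

section OperatorNorm

open scoped Matrix.Norms.L2Operator

variable {n : ℕ}

theorem norm_toEuclideanCLM_apply_le (A : Matrix (Fin n) (Fin n) ℝ)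
    (x : EuclideanSpace ℝ (Fin n)) :
    ‖Matrix.toEuclideanCLM (𝕜 := ℝ) A x‖ ≤ ‖A‖ * ‖x‖ := by
  rw [Matrix.cstar_norm_def]
  exact ContinuousLinearMap.le_opNorm _ _

theorem sum_mul_mul_le_norm (A : Matrix (Fin n) (Fin n) ℝ) (x y : EuclideanSpace ℝ (Fin n)) :
    |x.ofLp ⬝ᵥ A.mulVec y.ofLp| ≤ ‖A‖ * ‖x‖ * ‖y‖ := by
  rw [← Matrix.inner_toEuclideanCLM]
  refine (abs_real_inner_le_norm _ _).trans ?_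
  have := norm_toEuclideanCLM_apply_le A y
  calc _ ≤ ‖x‖ * (‖A‖ * ‖y‖) := by gcongr
    _ = _ := by ring

theorem norm_sq_le_sum_sq (A : Matrix (Fin n) (Fin n) ℝ) : ‖A‖ ^ 2 ≤ ∑ i, ∑ j, A i j ^ 2 := by
  have hnn : 0 ≤ ∑ i, ∑ j, A i j ^ 2 :=
    Finset.sum_nonneg fun i _ => Finset.sum_nonneg fun j _ => sq_nonneg _
  rw [← Real.sqrt_le_sqrt_iff hnn, Real.sqrt_sq (norm_nonneg _), Matrix.cstar_norm_def]
  refine ContinuousLinearMap.opNorm_le_bound _ (Real.sqrt_nonneg _) fun x => ?_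
  refine (sq_le_sq₀ (norm_nonneg _) (by positivity)).1 ?_
  rw [mul_pow, Real.sq_sqrt hnn, EuclideanSpace.real_norm_sq_eq, EuclideanSpace.real_norm_sq_eq,
    Finset.sum_mul]
  refine Finset.sum_le_sum fun i _ => ?_
  rw [Matrix.ofLp_toEuclideanCLM]
  exact Finset.sum_mul_sq_le_sq_mul_sq Finset.univ (fun j => A i j) (fun j => x.ofLp j)

theorem trace_le_card_mul_norm (A : Matrix (Fin n) (Fin n) ℝ) : A.trace ≤ n * ‖A‖ := by
  have : ∀ i, A i i ≤ ‖A‖ := by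
    intro i
    have h := sum_mul_mul_le_norm A (EuclideanSpace.single i 1) (EuclideanSpace.single i 1)
    simp only [PiLp.ofLp_single, Matrix.mulVec_single_one, single_one_dotProduct,
      PiLp.norm_single, norm_one, mul_one] at h
    exact (le_abs_self _).trans h
  calc A.trace = ∑ i, A i i := rfl
    _ ≤ ∑ _i : Fin n, ‖A‖ := Finset.sum_le_sum fun i _ => this i
    _ = n * ‖A‖ := by simp

theorem trace_pow_le [NeZero n] (A : Matrix (Fin n) (Fin n) ℝ) (L : ℕ) :
    (A ^ L).trace ≤ n * ‖A‖ ^ L := by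
  refine (trace_le_card_mul_norm _).trans ?_
  gcongr
  exact norm_pow_le _ _

/-- For exponents that are powers of two, the C*-identity gives `‖A^(2^j)‖ = ‖A‖^(2^j)` without
diagonalizing. The squared Frobenius norm of `A^(2^j)` is then the trace. -/
theorem norm_pow_le_trace (A : Matrix (Fin n) (Fin n) ℝ) (hA : ∀ i j, A i j = A j i) (j : ℕ) :
    ‖A‖ ^ 2 ^ (j + 1) ≤ (A ^ 2 ^ (j + 1)).trace := by
  have hsa : IsSelfAdjoint A := by
    ext i j
    simp [Matrix.star_apply, hA i j]
  have hsq : ∀ a b, (A ^ 2 ^ j) a b = (A ^ 2 ^ j) b a := by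
    intro a b
    have h : star (A ^ 2 ^ j) = A ^ 2 ^ j := hsa.pow (2 ^ j)
    have := congrFun (congrFun h b) a
    simpa [Matrix.star_apply] using this
  rw [pow_succ, pow_mul, pow_mul, ← hsa.norm_pow_two_pow, sq (A ^ 2 ^ j)]
  refine (norm_sq_le_sum_sq _).trans (le_of_eq ?_)
  simp only [Matrix.trace, Matrix.diag, Matrix.mul_apply]
  refine Finset.sum_congr rfl fun a _ => Finset.sum_congr rfl fun b _ => ?_
  rw [hsq b a, sq]

/-! ### A lattice net -/

/-- The integer points `a` with `|a|² ≤ 4 r`. -/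
noncomputable def latticeNet (r : ℕ) : Finset (Fin r → ℤ) :=
  (Fintype.piFinset fun _ => Finset.Icc (-(2 * r : ℤ)) (2 * r)).filter
    fun a => ∑ i, a i ^ 2 ≤ 4 * r

theorem mem_latticeNet {r : ℕ} {a : Fin r → ℤ} :
    a ∈ latticeNet r ↔ ∑ i, a i ^ 2 ≤ 4 * r := by
  refine ⟨fun h => (Finset.mem_filter.1 h).2, fun h => Finset.mem_filter.2 ⟨?_, h⟩⟩
  refine Fintype.mem_piFinset.2 fun i => ?_
  have h1 : a i ^ 2 ≤ 4 * r :=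
    (Finset.single_le_sum (f := fun i => a i ^ 2) (fun i _ => sq_nonneg (a i))
      (Finset.mem_univ i)).trans h
  have hr : (1 : ℤ) ≤ r := by have := i.2; omega
  rw [Finset.mem_Icc]
  exact abs_le.1 (abs_le_of_sq_le_sq (by nlinarith) (by positivity))

theorem sum_Icc_exp_neg_sq_le (R : ℕ) :
    ∑ c ∈ Finset.Icc (-(R : ℤ)) R, Real.exp (-(c : ℝ) ^ 2) ≤ 4 := by
  have hsub : Finset.Icc (-(R : ℤ)) R ⊆
      (Finset.range (R + 1)).image (fun m : ℕ => (m : ℤ)) ∪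
        (Finset.range (R + 1)).image (fun m : ℕ => -(m : ℤ)) := by
    intro c hc
    rw [Finset.mem_Icc] at hc
    rw [Finset.mem_union, Finset.mem_image, Finset.mem_image]
    rcases le_total 0 c with h | h
    · exact Or.inl ⟨c.toNat, by rw [Finset.mem_range]; omega, by omega⟩
    · exact Or.inr ⟨(-c).toNat, by rw [Finset.mem_range]; omega, by omega⟩
  have hgeo : ∑ m ∈ Finset.range (R + 1), Real.exp (-(m : ℝ) ^ 2) ≤ 2 := by
    have h1 : ∀ m : ℕ, Real.exp (-(m : ℝ) ^ 2) ≤ (1 / 2) ^ m := by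
      intro m
      have h2 : Real.exp (-1) ≤ 1 / 2 := by
        rw [Real.exp_neg, inv_le_comm₀ (Real.exp_pos _) (by norm_num)]
        have := Real.add_one_le_exp (1 : ℝ)
        norm_num at this ⊢
        exact this
      calc Real.exp (-(m : ℝ) ^ 2) ≤ Real.exp (m * (-1)) := by
            rw [Real.exp_le_exp]
            have : (m : ℝ) ≤ (m : ℝ) ^ 2 := by exact_mod_cast Nat.le_self_pow two_ne_zero m
            linarith
        _ = Real.exp (-1) ^ m := Real.exp_nat_mul _ _
        _ ≤ (1 / 2) ^ m := by gcongr
    exact (Finset.sum_le_sum fun m _ => h1 m).trans (sum_geometric_two_le _)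
  refine (Finset.sum_le_sum_of_subset_of_nonneg hsub fun _ _ _ => (Real.exp_pos _).le).trans ?_
  refine (le_add_of_nonneg_right (Finset.sum_nonneg fun _ _ => (Real.exp_pos _).le)).trans
    (Finset.sum_union_inter).le |>.trans ?_
  rw [Finset.sum_image (by intro a _ b _ h; simpa using h),
    Finset.sum_image (by intro a _ b _ h; simpa using h)]
  simp only [Int.cast_neg, Int.cast_natCast, even_two.neg_pow]
  linarith

/-- Each net point has Gaussian weight `exp(-|a|²) ≥ exp(-4r)`, and the total weight over the
enclosing box factorizes into one-dimensional sums, each at most `4`. -/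
theorem card_latticeNet_le (r : ℕ) : ((latticeNet r).card : ℝ) ≤ (4 * Real.exp 4) ^ r := by
  have h1 : ∀ a ∈ latticeNet r, (1 : ℝ) ≤ Real.exp (4 * r) * ∏ i, Real.exp (-(a i : ℝ) ^ 2) := by
    intro a ha
    rw [← Real.exp_sum, ← Real.exp_add, Real.one_le_exp_iff, Finset.sum_neg_distrib]
    have : ((∑ i, a i ^ 2 : ℤ) : ℝ) ≤ ((4 * r : ℤ) : ℝ) := by exact_mod_cast mem_latticeNet.1 ha
    push_cast at this
    linarith
  calc ((latticeNet r).card : ℝ) = ∑ a ∈ latticeNet r, (1 : ℝ) := by simp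
    _ ≤ ∑ a ∈ latticeNet r, Real.exp (4 * r) * ∏ i, Real.exp (-(a i : ℝ) ^ 2) :=
        Finset.sum_le_sum h1
    _ ≤ ∑ a ∈ Fintype.piFinset fun _ => Finset.Icc (-(2 * r : ℤ)) (2 * r),
          Real.exp (4 * r) * ∏ i : Fin r, Real.exp (-(a i : ℝ) ^ 2) :=
        Finset.sum_le_sum_of_subset_of_nonneg (Finset.filter_subset _ _)
          fun _ _ _ => by positivity
    _ = Real.exp (4 * r) *
          (∑ c ∈ Finset.Icc (-(2 * r : ℤ)) (2 * r), Real.exp (-(c : ℝ) ^ 2)) ^ r := by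
        rw [← Finset.mul_sum,
          ← Finset.prod_univ_sum (fun _ : Fin r => Finset.Icc (-(2 * r : ℤ)) (2 * r))
            (fun _ c => Real.exp (-(c : ℝ) ^ 2)), Finset.prod_const, Finset.card_univ,
          Fintype.card_fin]
    _ ≤ Real.exp (4 * r) * 4 ^ r := by
        have := sum_Icc_exp_neg_sq_le (2 * r)
        push_cast at this
        gcongr
    _ = (4 * Real.exp 4) ^ r := by rw [mul_pow, ← Real.exp_nat_mul]; ring_nf

/-- A vector in the unit ball, scaled by `√r`, can be rounded to the net without decreasing a given
linear functional. -/
theorem exists_mem_latticeNet {r : ℕ} (x g : Fin r → ℝ) (hx : ∑ i, x i ^ 2 ≤ 1) :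
    ∃ a ∈ latticeNet r, √r * ∑ i, x i * g i ≤ ∑ i, (a i : ℝ) * g i := by
  -- Each coordinate is rounded in the direction of the sign of `g i`. An integer within `1` of `y`
  -- has square at most `2y² + 2`, so the total is at most `2r + 2r`.
  refine ⟨fun i => if 0 ≤ g i then ⌈√r * x i⌉ else ⌊√r * x i⌋, ?_, ?_⟩
  · rw [mem_latticeNet]
    have hb : ∀ i, ((if 0 ≤ g i then ⌈√r * x i⌉ else ⌊√r * x i⌋ : ℤ) : ℝ) ^ 2 ≤
        2 * (r * x i ^ 2) + 2 := by
      intro i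
      have hs : r * x i ^ 2 = (√r * x i) ^ 2 := by
        rw [mul_pow, Real.sq_sqrt (Nat.cast_nonneg r)]
      rw [hs]
      generalize √r * x i = y
      split_ifs
      · have h1 := Int.le_ceil y
        have h2 := (Int.ceil_lt_add_one y).le
        nlinarith [sq_nonneg (2 * y - ⌈y⌉)]
      · have h1 := Int.floor_le y
        have h2 := (Int.lt_floor_add_one y).le
        nlinarith [sq_nonneg (2 * y - ⌊y⌋)]
    have := Finset.sum_le_sum fun i (_ : i ∈ Finset.univ) => hb i
    rw [Finset.sum_add_distrib, ← Finset.mul_sum, ← Finset.mul_sum] at this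
    simp only [Finset.sum_const, Finset.card_univ, Fintype.card_fin, nsmul_eq_mul] at this
    have h2 : (r : ℝ) * ∑ i, x i ^ 2 ≤ r := mul_le_of_le_one_right (Nat.cast_nonneg r) hx
    rw [← Int.cast_le (R := ℝ)]
    push_cast at this ⊢
    linarith
  · rw [Finset.mul_sum]
    refine Finset.sum_le_sum fun i _ => ?_
    rw [← mul_assoc]
    dsimp only
    split_ifs with h
    · exact mul_le_mul_of_nonneg_right (Int.le_ceil _) h
    · exact mul_le_mul_of_nonpos_right (Int.floor_le _) (not_le.1 h).le

/-- Rounding never decreases the linear functional, so there is no approximation loss: the two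
scalings by `√r` account exactly for the factor `r`. -/
theorem norm_le_of_latticeNet {r : ℕ} (A : Matrix (Fin r) (Fin r) ℝ) {T : ℝ} (hT : 0 ≤ T)
    (h : ∀ a ∈ latticeNet r, ∀ b ∈ latticeNet r, ∑ i, ∑ j, (a i : ℝ) * A i j * b j ≤ r * T) :
    ‖A‖ ≤ T := by
  rw [Matrix.cstar_norm_def]
  refine ContinuousLinearMap.opNorm_le_of_unit_norm hT fun x hx => ?_
  set w := Matrix.toEuclideanCLM (𝕜 := ℝ) A x with hw
  by_cases hw0 : w = 0
  · rw [hw0, norm_zero]; exact hT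
  set y : EuclideanSpace ℝ (Fin r) := ‖w‖⁻¹ • w with hy
  have hwn : ‖w‖ ≠ 0 := norm_ne_zero_iff.2 hw0
  have hyn : ‖y‖ = 1 := by rw [hy, norm_smul, norm_inv, norm_norm, inv_mul_cancel₀ hwn]
  have key : ‖w‖ = ∑ i, y i * ∑ j, A i j * x j := by
    have h1 : inner ℝ y w = ‖w‖ := by
      rw [hy, real_inner_smul_left, real_inner_self_eq_norm_sq]
      field_simp
    rw [← h1, hw, Matrix.inner_toEuclideanCLM]
    rfl
  have hr : 0 < (r : ℝ) := by
    rcases Nat.eq_zero_or_pos r with h0 | h0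
    · subst h0
      exact absurd (Subsingleton.elim w 0) hw0
    · exact_mod_cast h0
  have hsq : ∀ z : EuclideanSpace ℝ (Fin r), ‖z‖ = 1 → ∑ i, z i ^ 2 ≤ 1 := by
    intro z hz
    rw [← EuclideanSpace.real_norm_sq_eq, hz, one_pow]
  -- The left vector is rounded against `A x`; the right one is then rounded against `Aᵀ a`, which
  -- already involves the rounded left vector.
  obtain ⟨a, ha, ha'⟩ := exists_mem_latticeNet y.ofLp (fun i => ∑ j, A i j * x j) (hsq y hyn)
  obtain ⟨b, hb, hb'⟩ := exists_mem_latticeNet x.ofLp (fun j => ∑ i, (a i : ℝ) * A i j) (hsq x hx)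
  have e1 : ∑ i, (a i : ℝ) * ∑ j, A i j * x j = ∑ j, x j * ∑ i, (a i : ℝ) * A i j := by
    simp only [Finset.mul_sum]
    rw [Finset.sum_comm]
    exact Finset.sum_congr rfl fun _ _ => Finset.sum_congr rfl fun _ _ => by ring
  have e2 : ∑ j, (b j : ℝ) * ∑ i, (a i : ℝ) * A i j = ∑ i, ∑ j, (a i : ℝ) * A i j * b j := by
    simp only [Finset.mul_sum]
    rw [Finset.sum_comm]
    exact Finset.sum_congr rfl fun _ _ => Finset.sum_congr rfl fun _ _ => by ring
  rw [← key] at ha'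
  rw [e1] at ha'
  rw [e2] at hb'
  have h3 := hb'.trans (h a ha b hb)
  have h4 := mul_le_mul_of_nonneg_left ha' (Real.sqrt_nonneg r)
  rw [← mul_assoc, Real.mul_self_sqrt hr.le] at h4
  exact le_of_mul_le_mul_left (h4.trans h3) hr

/-- The norm is at most the maximum over the net divided by `r`, and the exponential of a maximum is
at most the sum of exponentials. The zero vector in the net makes the maximum nonnegative. -/
theorem exp_norm_le_sum {r : ℕ} (hr : 0 < r) (A : Matrix (Fin r) (Fin r) ℝ) {c : ℝ} (hc : 0 ≤ c) :
    Real.exp (c * ‖A‖) ≤ ∑ a ∈ latticeNet r, ∑ b ∈ latticeNet r,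
      Real.exp (c / r * ∑ i, ∑ j, (a i : ℝ) * A i j * b j) := by
  have hr' : (0 : ℝ) < r := by exact_mod_cast hr
  have h0 : (0 : Fin r → ℤ) ∈ latticeNet r := by rw [mem_latticeNet]; simp
  let F : (Fin r → ℤ) × (Fin r → ℤ) → ℝ := fun z => ∑ i, ∑ j, (z.1 i : ℝ) * A i j * z.2 j
  have h00 : ((0, 0) : (Fin r → ℤ) × (Fin r → ℤ)) ∈ latticeNet r ×ˢ latticeNet r :=
    Finset.mem_product.2 ⟨h0, h0⟩
  obtain ⟨⟨a, b⟩, hab, hmax⟩ := Finset.exists_max_image (latticeNet r ×ˢ latticeNet r) F ⟨_, h00⟩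
  have hpos : 0 ≤ F (a, b) := by
    refine le_trans (le_of_eq ?_) (hmax _ h00)
    simp [F]
  rw [Finset.mem_product] at hab
  have hle : ‖A‖ ≤ (∑ i, ∑ j, (a i : ℝ) * A i j * b j) / r := by
    refine norm_le_of_latticeNet A (div_nonneg hpos hr'.le) fun a' ha' b' hb' => ?_
    rw [mul_div_cancel₀ _ hr'.ne']
    exact hmax (a', b') (Finset.mem_product.2 ⟨ha', hb'⟩)
  have h1 : Real.exp (c * ‖A‖) ≤ Real.exp (c / r * F (a, b)) := by
    rw [Real.exp_le_exp]
    calc c * ‖A‖ ≤ c * (F (a, b) / r) := mul_le_mul_of_nonneg_left hle hc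
      _ = _ := by ring
  refine h1.trans ?_
  rw [← Finset.sum_product' (f := fun a b : Fin r → ℤ => Real.exp (c / r * F (a, b)))]
  exact Finset.single_le_sum (f := fun z => Real.exp (c / r * F z))
      (fun _ _ => (Real.exp_pos _).le) (Finset.mem_product.2 hab)

end OperatorNorm

/-! ### Norm concentration by comparison with a dense reference matrix -/

section NormConcentration

open scoped Matrix.Norms.L2Operator

theorem sum_nodePair {n : ℕ} (h : Fin n → Fin n → ℝ) :
    ∑ e : NodePair n, h e.1.1 e.1.2 = ∑ i, ∑ j, if i < j then h i j else 0 := by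
  rw [← Fintype.sum_prod_type' (f := fun i j => if i < j then h i j else 0), ← Finset.sum_filter]
  exact (Finset.sum_subtype _ (by simp) fun z : Fin n × Fin n => h z.1 z.2).symm

theorem sum_sum_eq_sum_nodePair {n : ℕ} (f : Fin n → Fin n → ℝ) :
    ∑ i, ∑ j, f i j = ∑ i, f i i + ∑ e : NodePair n, (f e.1.1 e.1.2 + f e.1.2 e.1.1) := by
  rw [Finset.sum_add_distrib, sum_nodePair f, sum_nodePair fun i j => f j i,
    Finset.sum_comm (f := fun i j => if i < j then f j i else 0)]
  simp only [← Finset.sum_add_distrib]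
  refine Finset.sum_congr rfl fun i _ => ?_
  have : f i i = ∑ j, if i = j then f i j else 0 := by simp
  rw [this]
  simp only [← Finset.sum_add_distrib]
  refine Finset.sum_congr rfl fun j _ => ?_
  rcases lt_trichotomy i j with h | h | h
  · simp [h, h.ne, h.not_gt]
  · simp [h]
  · simp [h, h.ne', h.not_gt]

theorem bilinear_pairMatrix {n : ℕ} (x : NodePair n → ℝ) (a b : Fin n → ℝ) :
    ∑ i, ∑ j, a i * pairMatrix x i j * b j =
      ∑ e, (a e.1.1 * b e.1.2 + a e.1.2 * b e.1.1) * x e := by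
  rw [sum_sum_eq_sum_nodePair]
  simp only [pairMatrix_self, mul_zero, zero_mul, Finset.sum_const_zero, zero_add]
  refine Finset.sum_congr rfl fun e _ => ?_
  rw [pairMatrix_comm x e.1.2 e.1.1]
  have : pairMatrix x e.1.1 e.1.2 = x e := by simp [pairMatrix, e.2]
  rw [this]
  ring

/-- A centered two-valued law all of whose moments of order at least `2` are at least `1`. -/
noncomputable def skewCoin : Measure Bool :=
  bernoulliMeasure true false ⟨1 / 3, by norm_num, by norm_num⟩

def skewValue (b : Bool) : ℝ := if b then 2 else -1

instance : IsProbabilityMeasure skewCoin := by unfold skewCoin; infer_instance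

theorem integral_skewCoin (f : Bool → ℝ) :
    ∫ x, f x ∂skewCoin = 1 / 3 * f true + 2 / 3 * f false := by
  rw [skewCoin, integral_bernoulliMeasure]
  simp only [smul_eq_mul]
  norm_num

theorem integral_skewValue : ∫ x, skewValue x ∂skewCoin = 0 := by
  rw [integral_skewCoin]; norm_num [skewValue]

/-- A symmetric sign would not do: its odd moments vanish, whereas a doubled walk may use an edge
three times. Here the value `2` outweighs `-1` from order three on. -/
theorem one_le_integral_skewValue_pow {c : ℕ} (hc : 2 ≤ c) :
    1 ≤ ∫ x, skewValue x ^ c ∂skewCoin := by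
  rw [integral_skewCoin]
  simp only [skewValue, if_true, Bool.false_eq_true, if_false]
  rcases Nat.lt_or_ge c 3 with h | h
  · have : c = 2 := by omega
    subst this; norm_num
  · have h1 : (2 : ℝ) ^ 3 ≤ 2 ^ c := pow_le_pow_right₀ (by norm_num) h
    rcases neg_one_pow_eq_or ℝ c with h2 | h2 <;> rw [h2] <;> linarith

/-- Hoeffding's lemma on an interval of length `3`: the variance proxy is `(3/2)²`, and half of it
is `9/8`. -/
theorem integral_exp_skewValue_le (t : ℝ) :
    ∫ x, Real.exp (t * skewValue x) ∂skewCoin ≤ Real.exp (9 / 8 * t ^ 2) := by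
  have h := (hasSubgaussianMGF_of_mem_Icc_of_integral_eq_zero (μ := skewCoin) (X := skewValue)
    (a := -1) (b := 2) (by fun_prop) (ae_of_all _ fun x => by
      cases x <;> simp [skewValue] <;> norm_num) integral_skewValue).mgf_le t
  rw [mgf] at h
  refine h.trans (le_of_eq ?_)
  congr 1
  have : ‖(2 : ℝ) - -1‖ = 3 := by norm_num
  push_cast
  rw [this]
  ring

/-- The reference matrix, with independent entries of law `skewValue` off the diagonal. -/
noncomputable def skewMatrix {r : ℕ} (ω : NodePair r → Bool) : Matrix (Fin r) (Fin r) ℝ :=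
  pairMatrix fun e => skewValue (ω e)

noncomputable def skewMeasure (r : ℕ) : Measure (NodePair r → Bool) := Measure.pi fun _ => skewCoin

instance (r : ℕ) : IsProbabilityMeasure (skewMeasure r) := by unfold skewMeasure; infer_instance

/-- By independence the sub-Gaussian bounds multiply over pairs. Symmetry puts `aᵢbⱼ + aⱼbᵢ` on one
coin; bounding its square by twice the sum of squares doubles `9/8` to `9/4`. -/
theorem integral_exp_bilinear_le {r : ℕ} (t : ℝ) (a b : Fin r → ℝ) :
    ∫ ω, Real.exp (t * ∑ i, ∑ j, a i * skewMatrix ω i j * b j) ∂skewMeasure r ≤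
      Real.exp (9 / 4 * t ^ 2 * ((∑ i, a i ^ 2) * ∑ i, b i ^ 2)) := by
  have h0 : ∀ ω : NodePair r → Bool, Real.exp (t * ∑ i, ∑ j, a i * skewMatrix ω i j * b j) =
      ∏ e : NodePair r,
        Real.exp (t * ((a e.1.1 * b e.1.2 + a e.1.2 * b e.1.1) * skewValue (ω e))) := by
    intro ω
    rw [skewMatrix, bilinear_pairMatrix, Finset.mul_sum, Real.exp_sum]
  simp only [h0, skewMeasure]
  rw [integral_fintype_prod_eq_prod (f := fun (e : NodePair r) (x : Bool) =>
    Real.exp (t * ((a e.1.1 * b e.1.2 + a e.1.2 * b e.1.1) * skewValue x)))]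
  have h1 : ∀ e : NodePair r, ∫ x, Real.exp (t * ((a e.1.1 * b e.1.2 + a e.1.2 * b e.1.1) *
      skewValue x)) ∂skewCoin ≤
      Real.exp (9 / 4 * t ^ 2 * ((a e.1.1 * b e.1.2) ^ 2 + (a e.1.2 * b e.1.1) ^ 2)) := by
    intro e
    simp only [← mul_assoc]
    refine (integral_exp_skewValue_le _).trans ?_
    rw [Real.exp_le_exp]
    have := add_sq_le (a := a e.1.1 * b e.1.2) (b := a e.1.2 * b e.1.1)
    have ht := sq_nonneg t
    nlinarith [mul_le_mul_of_nonneg_left this ht]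
  refine (Finset.prod_le_prod (fun _ _ => integral_nonneg fun _ => (Real.exp_pos _).le)
    fun e _ => h1 e).trans ?_
  rw [← Real.exp_sum, Real.exp_le_exp, ← Finset.mul_sum]
  refine mul_le_mul_of_nonneg_left ?_ (by positivity)
  have h2 : (∑ i, a i ^ 2) * ∑ i, b i ^ 2 = ∑ i, ∑ j, (a i * b j) ^ 2 := by
    rw [Finset.sum_mul_sum]
    simp only [mul_pow]
  rw [h2, sum_sum_eq_sum_nodePair]
  exact le_add_of_nonneg_left (Finset.sum_nonneg fun _ _ => sq_nonneg _)

/-- With `t² = 1/r` and `|a|²|b|² ≤ 16r²`, each net pair contributes at most `exp(36r)`. There are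
at most `(4e⁴)^(2r) ≤ exp(11r)` pairs, whence `47`. -/
theorem integral_exp_norm_skewMatrix_le {r : ℕ} (hr : 0 < r) :
    ∫ ω, Real.exp (√r * ‖skewMatrix ω‖) ∂skewMeasure r ≤ Real.exp (47 * r) := by
  have hr' : (0 : ℝ) < r := by exact_mod_cast hr
  have hnet : ∀ a ∈ latticeNet r, ∑ i, ((a i : ℤ) : ℝ) ^ 2 ≤ 4 * r := by
    intro a ha
    have : ((∑ i, a i ^ 2 : ℤ) : ℝ) ≤ ((4 * r : ℤ) : ℝ) := by exact_mod_cast mem_latticeNet.1 ha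
    push_cast at this
    exact this
  calc ∫ ω, Real.exp (√r * ‖skewMatrix ω‖) ∂skewMeasure r
      ≤ ∫ ω, ∑ a ∈ latticeNet r, ∑ b ∈ latticeNet r,
          Real.exp (√r / r * ∑ i, ∑ j, (a i : ℝ) * skewMatrix ω i j * b j) ∂skewMeasure r :=
        integral_mono Integrable.of_finite Integrable.of_finite
          fun ω => exp_norm_le_sum hr _ (Real.sqrt_nonneg _)
    _ = ∑ a ∈ latticeNet r, ∑ b ∈ latticeNet r,
          ∫ ω, Real.exp (√r / r * ∑ i, ∑ j, (a i : ℝ) * skewMatrix ω i j * b j)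
            ∂skewMeasure r := by
        rw [integral_finsetSum _ fun _ _ => Integrable.of_finite]
        exact Finset.sum_congr rfl fun a _ => integral_finsetSum _ fun _ _ => Integrable.of_finite
    _ ≤ ∑ a ∈ latticeNet r, ∑ b ∈ latticeNet r, Real.exp (36 * r) := by
        refine Finset.sum_le_sum fun a ha => Finset.sum_le_sum fun b hb => ?_
        refine (integral_exp_bilinear_le _ (fun i => (a i : ℝ)) fun i => (b i : ℝ)).trans ?_
        rw [Real.exp_le_exp, div_pow, Real.sq_sqrt hr'.le]
        have h1 : (∑ i, (a i : ℝ) ^ 2) * ∑ i, (b i : ℝ) ^ 2 ≤ (4 * r) * (4 * r) :=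
          mul_le_mul (hnet a ha) (hnet b hb) (Finset.sum_nonneg fun _ _ => sq_nonneg _)
            (by positivity)
        calc _ ≤ 9 / 4 * (r / r ^ 2 : ℝ) * ((4 * r) * (4 * r)) := by gcongr
          _ = 36 * r := by field_simp; norm_num
    _ = (latticeNet r).card * (latticeNet r).card * Real.exp (36 * r) := by
        simp [mul_assoc]
    _ ≤ (4 * Real.exp 4) ^ r * (4 * Real.exp 4) ^ r * Real.exp (36 * r) := by
        gcongr <;> exact card_latticeNet_le r
    _ ≤ Real.exp (47 * r) := by
        have h4 : (4 : ℝ) ^ 2 ≤ Real.exp 3 := by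
          have h := Real.exp_one_gt_d9.le
          have : Real.exp 3 = Real.exp 1 ^ 3 := by rw [← Real.exp_nat_mul]; norm_num
          rw [this]
          calc (4 : ℝ) ^ 2 ≤ 2.7182818283 ^ 3 := by norm_num
            _ ≤ _ := by gcongr
        have h5 : (4 * Real.exp 4) * (4 * Real.exp 4) ≤ Real.exp 11 := by
          calc (4 * Real.exp 4) * (4 * Real.exp 4) = 4 ^ 2 * Real.exp (4 + 4) := by
                rw [Real.exp_add]; ring
            _ ≤ Real.exp 3 * Real.exp (4 + 4) := by gcongr
            _ = Real.exp 11 := by rw [← Real.exp_add]; norm_num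
        calc _ = ((4 * Real.exp 4) * (4 * Real.exp 4)) ^ r * Real.exp (36 * r) := by
              rw [mul_pow (4 * Real.exp 4)]
          _ ≤ Real.exp 11 ^ r * Real.exp (36 * r) := by gcongr
          _ = Real.exp (47 * r) := by rw [← Real.exp_nat_mul, ← Real.exp_add]; ring_nf

/-- Turns an exponential moment into power moments of order up to `r`: beyond the threshold, with `z
= t / (K√r) ≥ 1`, one has `z^L ≤ z^r ≤ exp(r(z - 1))`. -/
theorem pow_le_mul_exp {K t : ℝ} {r L : ℕ} (hr : 0 < r) (hL : L ≤ r) (hK : 1 ≤ K) (ht : 0 ≤ t) :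
    t ^ L ≤ (K * √r) ^ L * (1 + Real.exp (√r * t - K * r)) := by
  have hr' : (0 : ℝ) < r := by exact_mod_cast hr
  have hs : 0 < √(r : ℝ) := Real.sqrt_pos.2 hr'
  rcases le_total t (K * √r) with h | h
  · calc t ^ L ≤ (K * √r) ^ L := by gcongr
      _ ≤ _ := le_mul_of_one_le_right (by positivity) (by have := Real.exp_pos (√r * t - K * r); linarith)
  · set z := t / (K * √r) with hz
    have hz1 : 1 ≤ z := by rw [hz, one_le_div (by positivity)]; exact h
    have ht' : t = K * √r * z := by rw [hz]; field_simp
    have h1 : z ^ L ≤ Real.exp (√r * t - K * r) := by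
      calc z ^ L ≤ z ^ r := pow_le_pow_right₀ hz1 hL
        _ ≤ Real.exp (z - 1) ^ r := by
            gcongr
            have := Real.add_one_le_exp (z - 1)
            linarith
        _ = Real.exp (r * (z - 1)) := (Real.exp_nat_mul _ _).symm
        _ ≤ Real.exp (√r * t - K * r) := by
            rw [Real.exp_le_exp, ht']
            have : √(r : ℝ) * (K * √r * z) = K * (r * z) := by
              rw [show √(r : ℝ) * (K * √r * z) = K * ((√r * √r) * z) by ring,
                Real.mul_self_sqrt hr'.le]
            rw [this]
            have : 0 ≤ r * (z - 1) := mul_nonneg hr'.le (by linarith)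
            nlinarith
    calc t ^ L = (K * √r) ^ L * z ^ L := by rw [← mul_pow, ← ht']
      _ ≤ (K * √r) ^ L * (1 + Real.exp (√r * t - K * r)) := by
          gcongr
          linarith

theorem integral_norm_skewMatrix_pow_le {r L : ℕ} (hr : 0 < r) (hL : L ≤ r) :
    ∫ ω, ‖skewMatrix ω‖ ^ L ∂skewMeasure r ≤ 2 * (47 * √r) ^ L := by
  calc ∫ ω, ‖skewMatrix ω‖ ^ L ∂skewMeasure r
      ≤ ∫ ω, (47 * √r) ^ L * (1 + Real.exp (-(47 * r)) * Real.exp (√r * ‖skewMatrix ω‖))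
          ∂skewMeasure r := by
        refine integral_mono Integrable.of_finite Integrable.of_finite fun ω => ?_
        refine (pow_le_mul_exp hr hL (K := 47) (by norm_num) (norm_nonneg _)).trans (le_of_eq ?_)
        rw [← Real.exp_add]
        ring_nf
    _ = (47 * √r) ^ L *
          (1 + Real.exp (-(47 * r)) * ∫ ω, Real.exp (√r * ‖skewMatrix ω‖) ∂skewMeasure r) := by
        rw [integral_const_mul, integral_add (integrable_const _) Integrable.of_finite,
          integral_const_mul]
        simp
    _ ≤ (47 * √r) ^ L * (1 + Real.exp (-(47 * r)) * Real.exp (47 * r)) := by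
        gcongr
        exact integral_exp_norm_skewMatrix_le hr
    _ = 2 * (47 * √r) ^ L := by
        rw [← Real.exp_add, neg_add_cancel, Real.exp_zero]
        ring

variable {n : ℕ} {α : Type*} [Finite α] [MeasurableSpace α] [MeasurableSingletonClass α]

/-- The comparison in one chain: norm moment, trace moment, weighted doubled walks on `n` vertices,
doubled walks on `r` vertices, reference trace moment, reference norm moment. -/
theorem integral_norm_pow_le (ν : NodePair n → Measure α) [∀ e, IsProbabilityMeasure (ν e)]
    (ξ : NodePair n → α → ℝ) {p : ℝ} (hp0 : 0 < p) (hp1 : p ≤ 1) (h1 : ∀ e x, |ξ e x| ≤ 1)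
    (hmean : ∀ e, ∫ x, ξ e x ∂ν e = 0) (hvar : ∀ e, ∫ x, ξ e x ^ 2 ∂ν e ≤ p) (j r : ℕ)
    (hr : n * p + (2 ^ (j + 1) : ℕ) ≤ r) :
    ∫ ω, ‖pairMatrix fun e => ξ e (ω e)‖ ^ 2 ^ (j + 1) ∂Measure.pi ν ≤
      p⁻¹ * (r * (2 * (47 * √r) ^ 2 ^ (j + 1))) := by
  have hnp : 0 ≤ n * p := by positivity
  have hLr : 2 ^ (j + 1) ≤ r := by
    have : ((2 ^ (j + 1) : ℕ) : ℝ) ≤ r := by linarith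
    exact_mod_cast this
  have hr0 : 0 < r := lt_of_lt_of_le (by positivity) hLr
  have : NeZero r := ⟨hr0.ne'⟩
  calc ∫ ω, ‖pairMatrix fun e => ξ e (ω e)‖ ^ 2 ^ (j + 1) ∂Measure.pi ν
      ≤ ∫ ω, ((pairMatrix fun e => ξ e (ω e)) ^ 2 ^ (j + 1)).trace ∂Measure.pi ν :=
        integral_mono Integrable.of_finite Integrable.of_finite
          fun ω => norm_pow_le_trace _ (pairMatrix_comm _) j
    _ ≤ _ := integral_trace_pow_le ν ξ hp0.le hp1 h1 hmean hvar _
    _ ≤ _ := sum_doubled_le (r := r) hp0 hr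
    _ ≤ p⁻¹ * ∫ ω, (skewMatrix ω ^ 2 ^ (j + 1)).trace ∂skewMeasure r := by
        gcongr
        exact le_integral_trace_pow (fun _ => skewCoin) (fun _ => skewValue)
          (fun _ => integral_skewValue) (fun _ _ hc => one_le_integral_skewValue_pow hc) _
    _ ≤ p⁻¹ * ∫ ω, r * ‖skewMatrix ω‖ ^ 2 ^ (j + 1) ∂skewMeasure r := by
        refine mul_le_mul_of_nonneg_left ?_ (inv_nonneg.2 hp0.le)
        exact integral_mono Integrable.of_finite Integrable.of_finite fun ω => trace_pow_le (skewMatrix ω) _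
    _ ≤ _ := by
        rw [integral_const_mul]
        gcongr
        exact integral_norm_skewMatrix_pow_le hr0 hLr

/-- A random symmetric matrix with independent centered entries bounded by `1` and of variance at
most `p` has norm `O(√(np))` with high probability. -/
theorem norm_pairMatrix_tail (ν : NodePair n → Measure α) [∀ e, IsProbabilityMeasure (ν e)]
    (ξ : NodePair n → α → ℝ) {p : ℝ} (hp0 : 0 < p) (hp1 : p ≤ 1) (hnp : 2 ≤ n * p)
    (h1 : ∀ e x, |ξ e x| ≤ 1)
    (hmean : ∀ e, ∫ x, ξ e x ∂ν e = 0) (hvar : ∀ e, ∫ x, ξ e x ^ 2 ∂ν e ≤ p) :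
    (Measure.pi ν).real {ω | 170 * √(n * p) ≤ ‖pairMatrix fun e => ξ e (ω e)‖} ≤
      6 * n * Real.exp (-(n * p / 4)) := by
  -- The moment order `L` is the largest power of two not exceeding `np`, so `np/2 ≤ L ≤ np`.
  set N := ⌊n * p⌋₊ with hN
  have hN2 : 2 ≤ N := Nat.le_floor (by exact_mod_cast hnp)
  obtain ⟨j, hj⟩ : ∃ j, Nat.log 2 N = j + 1 :=
    ⟨Nat.log 2 N - 1, by have := Nat.log_pos one_lt_two hN2; omega⟩
  set L := 2 ^ (j + 1) with hL
  have hLN : L ≤ N := by rw [hL, ← hj]; exact Nat.pow_log_le_self 2 (by omega)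
  have hLle : (L : ℝ) ≤ n * p := (Nat.le_floor_iff (by linarith)).1 hLN
  have hLgt : n * p ≤ 2 * L := by
    have h2 : N + 1 ≤ 2 ^ (Nat.log 2 N + 1) := Nat.lt_pow_succ_log_self one_lt_two N
    rw [hj, pow_succ, ← hL] at h2
    have h3 : n * p ≤ N + 1 := (Nat.lt_floor_add_one _).le
    have h4 : ((N + 1 : ℕ) : ℝ) ≤ ((L * 2 : ℕ) : ℝ) := by exact_mod_cast h2
    push_cast at h4
    linarith
  set r := ⌈n * p⌉₊ + L with hrdef
  have hr1 : n * p + L ≤ r := by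
    rw [hrdef]; push_cast
    have := Nat.le_ceil (n * p)
    linarith
  have hr3 : (r : ℝ) ≤ 3 * (n * p) := by
    rw [hrdef]; push_cast
    have := (Nat.ceil_lt_add_one (a := n * p) (by linarith)).le
    linarith
  have hr0 : (0 : ℝ) < r := by linarith
  -- Here `94 = 2 · 47`: Markov's inequality is used at twice the moment scale and gains `2^L`. As
  -- `r ≤ 3np` and `94√3 < 170`, this level lies below the stated threshold.
  have hsq : 94 * √(r : ℝ) ≤ 170 * √(n * p) := by
    have h3 : √(r : ℝ) ≤ √(3 * (n * p)) := Real.sqrt_le_sqrt hr3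
    rw [Real.sqrt_mul (by norm_num)] at h3
    have h4 : √(3 : ℝ) ≤ 1.8 := by
      rw [Real.sqrt_le_left (by norm_num)]; norm_num
    have h5 := Real.sqrt_nonneg (n * p)
    nlinarith [mul_le_mul_of_nonneg_right h4 h5]
  have hsub : (Measure.pi ν).real {ω | 170 * √(n * p) ≤ ‖pairMatrix fun e => ξ e (ω e)‖} ≤
      (Measure.pi ν).real {ω | (94 * √r) ^ L ≤ ‖pairMatrix fun e => ξ e (ω e)‖ ^ L} := by
    refine measureReal_mono fun ω hω => ?_
    simp only [Set.mem_ofPred_eq] at hω ⊢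
    gcongr
    exact hsq.trans hω
  have hmarkov := mul_meas_ge_le_integral_of_nonneg (μ := Measure.pi ν)
    (f := fun ω => ‖pairMatrix fun e => ξ e (ω e)‖ ^ L) (ae_of_all _ fun ω => by positivity)
    Integrable.of_finite ((94 * √r) ^ L)
  have hmom := integral_norm_pow_le ν ξ hp0 hp1 h1 hmean hvar j r hr1
  have hpos : 0 < (47 * √(r : ℝ)) ^ L := by positivity
  have h94 : (94 * √(r : ℝ)) ^ L = 2 ^ L * (47 * √r) ^ L := by rw [← mul_pow]; ring_nf
  have hexp : Real.exp (n * p / 4) ≤ 2 ^ L := by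
    calc Real.exp (n * p / 4) ≤ Real.exp (L * (1 / 2)) := by
          rw [Real.exp_le_exp]; linarith
      _ = Real.exp (1 / 2) ^ L := Real.exp_nat_mul _ _
      _ ≤ 2 ^ L := by
          gcongr
          rw [← Real.le_log_iff_exp_le (by norm_num)]
          have := Real.log_two_gt_d9
          linarith
  set P := (Measure.pi ν).real {ω | (94 * √r) ^ L ≤ ‖pairMatrix fun e => ξ e (ω e)‖ ^ L}
  have hP : 2 ^ L * P ≤ 6 * n := by
    have h6 := hmarkov.trans hmom
    rw [h94] at h6
    have h7 : (47 * √(r : ℝ)) ^ L * (2 ^ L * P) ≤ (47 * √(r : ℝ)) ^ L * (p⁻¹ * (r * 2)) := by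
      calc _ = 2 ^ L * (47 * √(r : ℝ)) ^ L * P := by ring
        _ ≤ _ := h6
        _ = _ := by rw [hL]; ring
    refine (le_of_mul_le_mul_left h7 hpos).trans ?_
    rw [inv_mul_le_iff₀ hp0]
    linarith
  refine hsub.trans ?_
  rw [Real.exp_neg, ← div_eq_mul_inv, le_div_iff₀ (Real.exp_pos _)]
  refine le_trans ?_ hP
  rw [mul_comm]
  gcongr

end NormConcentration

/-! ### A perturbation bound for the first eigenvector -/

section Eigenvector

open scoped RealInnerProductSpace

variable {n : ℕ}

theorem toEuclideanLin_isSymmetric {X : Matrix (Fin n) (Fin n) ℝ} (hX : ∀ i j, X i j = X j i) :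
    (Matrix.toEuclideanLin X).IsSymmetric := by
  rw [Matrix.isSymmetric_toEuclideanLin_iff]
  ext i j
  simp [Matrix.conjTranspose_apply, hX i j]

/-- The infimum of the Rayleigh quotient is an eigenvalue and bounds every eigenvalue from below, so
it is the least one. -/
theorem lambdaOne_spec [NeZero n] {X : Matrix (Fin n) (Fin n) ℝ} (hX : ∀ i j, X i j = X j i) :
    Module.End.HasEigenvalue (Matrix.toEuclideanLin X) (lambdaOne X) ∧
      ∀ x, lambdaOne X * ‖x‖ ^ 2 ≤ ⟪x, Matrix.toEuclideanLin X x⟫ := by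
  have hsym := toEuclideanLin_isSymmetric hX
  set T := Matrix.toEuclideanLin X with hT
  set R : EuclideanSpace ℝ (Fin n) → ℝ := fun x => ⟪T x, x⟫ / ‖x‖ ^ 2 with hR
  have hev : Module.End.HasEigenvalue T (⨅ x : { x : EuclideanSpace ℝ (Fin n) // x ≠ 0 }, R x) :=
    hsym.hasEigenvalue_iInf_of_finiteDimensional
  have hbdd : BddBelow (Set.range fun x : { x : EuclideanSpace ℝ (Fin n) // x ≠ 0 } => R x) := by
    refine ⟨-‖T.toContinuousLinearMap‖, ?_⟩
    rintro _ ⟨⟨x, hx⟩, rfl⟩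
    have hx' : 0 < ‖x‖ := norm_pos_iff.2 hx
    simp only [hR]
    rw [le_div_iff₀ (by positivity)]
    have h1 := abs_real_inner_le_norm (T x) x
    have h2 : ‖T x‖ ≤ ‖T.toContinuousLinearMap‖ * ‖x‖ := T.toContinuousLinearMap.le_opNorm x
    have h3 := (abs_le.1 h1).1
    nlinarith
  have hle : ∀ μ, Module.End.HasEigenvalue T μ →
      (⨅ x : { x : EuclideanSpace ℝ (Fin n) // x ≠ 0 }, R x) ≤ μ := by
    intro μ hμ
    obtain ⟨v, hv⟩ := hμ.exists_hasEigenvector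
    refine (ciInf_le hbdd ⟨v, hv.2⟩).trans (le_of_eq ?_)
    have hv' : ‖v‖ ≠ 0 := norm_ne_zero_iff.2 hv.2
    simp only [hR]
    rw [hv.apply_eq_smul, real_inner_smul_left, real_inner_self_eq_norm_sq]
    field_simp
  have heq : lambdaOne X = ⨅ x : { x : EuclideanSpace ℝ (Fin n) // x ≠ 0 }, R x :=
    le_antisymm (csInf_le ⟨_, fun μ hμ => hle μ hμ⟩ hev) (le_csInf ⟨_, hev⟩ hle)
  rw [heq]
  refine ⟨hev, fun x => ?_⟩
  by_cases hx : x = 0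
  · simp [hx]
  · have hx' : 0 < ‖x‖ := norm_pos_iff.2 hx
    have := ciInf_le hbdd ⟨x, hx⟩
    simp only [hR] at this
    rw [le_div_iff₀ (by positivity)] at this
    rwa [real_inner_comm]

/-- If the quadratic form of `M` is at least `μ` at the unit vector `b` and at most `β < μ` on the
orthogonal complement of `b`, then the first eigenvector of `1 - M` is close to `b`. -/
theorem first_eigenvector_perturbation [NeZero n] {M : Matrix (Fin n) (Fin n) ℝ}
    (hM : ∀ i j, M i j = M j i) {b : EuclideanSpace ℝ (Fin n)} (hb : ‖b‖ = 1) {μ β ρ : ℝ}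
    (hgap : β < μ) (hμ : μ ≤ ⟪b, Matrix.toEuclideanLin M b⟫)
    (hβ : ∀ w, ⟪b, w⟫ = 0 → ⟪w, Matrix.toEuclideanLin M w⟫ ≤ β * ‖w‖ ^ 2)
    (hρ : ∀ w, ⟪b, w⟫ = 0 → |⟪w, Matrix.toEuclideanLin M b⟫| ≤ ρ * ‖w‖) :
    LambdaOneSimple (1 - M) ∧
      (∀ u v, IsUnitEigenvectorOne (1 - M) u → IsUnitEigenvectorOne (1 - M) v → v = u ∨ v = -u) ∧
      ∀ u, IsUnitEigenvectorOne (1 - M) u →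
        ∃ τ : ℝ, (τ = 1 ∨ τ = -1) ∧ ‖τ • u - b‖ ^ 2 ≤ 2 * (ρ / (μ - β)) ^ 2 := by
  have hsym : ∀ i j, (1 - M) i j = (1 - M) j i := by
    intro i j
    simp [Matrix.sub_apply, Matrix.one_apply, hM i j, eq_comm]
  obtain ⟨hev, hmin⟩ := lambdaOne_spec hsym
  set lam := lambdaOne (1 - M) with hlam
  have hL : ∀ x, Matrix.toEuclideanLin (1 - M) x = x - Matrix.toEuclideanLin M x := by
    intro x
    rw [map_sub, LinearMap.sub_apply]
    congr 1
    simp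
  have hlammu : lam ≤ 1 - μ := by
    have h := hmin b
    rw [hL, inner_sub_right, real_inner_self_eq_norm_sq, hb] at h
    linarith
  have hMx : ∀ x ∈ Module.End.eigenspace (Matrix.toEuclideanLin (1 - M)) lam,
      Matrix.toEuclideanLin M x = (1 - lam) • x := by
    intro x hx
    rw [Module.End.mem_eigenspace_iff, hL] at hx
    rw [sub_smul, one_smul, ← hx, sub_sub_cancel]
  -- On the eigenspace the form of `M` equals `(1 - lam)‖x‖²` with `1 - lam ≥ μ > β`, which is
  -- impossible for nonzero `x ⊥ b`. The eigenspace thus meets `bᗮ` trivially and is a line.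
  have hzero : ∀ x ∈ Module.End.eigenspace (Matrix.toEuclideanLin (1 - M)) lam,
      ⟪b, x⟫ = 0 → x = 0 := by
    intro x hx hbx
    have h := hβ x hbx
    rw [hMx x hx, real_inner_smul_right, real_inner_self_eq_norm_sq] at h
    by_contra hne
    have : 0 < ‖x‖ ^ 2 := by have := norm_pos_iff.2 hne; positivity
    nlinarith
  obtain ⟨v, hv⟩ := hev.exists_hasEigenvector
  have hspan : ∀ w ∈ Module.End.eigenspace (Matrix.toEuclideanLin (1 - M)) lam,
      ∀ v ∈ Module.End.eigenspace (Matrix.toEuclideanLin (1 - M)) lam, v ≠ 0 →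
      ∃ c : ℝ, c • v = w := by
    intro w hw v hv hv0
    have hbv : ⟪b, v⟫ ≠ 0 := fun h => hv0 (hzero v hv h)
    refine ⟨⟪b, w⟫ / ⟪b, v⟫, ?_⟩
    have hmem := Submodule.sub_mem _ hw (Submodule.smul_mem _ (⟪b, w⟫ / ⟪b, v⟫) hv)
    have := hzero _ hmem (by rw [inner_sub_right, real_inner_smul_right]; field_simp; ring)
    exact (sub_eq_zero.1 this).symm
  refine ⟨?_, ?_, ?_⟩
  · rw [LambdaOneSimple, finrank_eq_one_iff']
    refine ⟨⟨v, hv.1⟩, fun h => hv.2 (congrArg Subtype.val h), ?_⟩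
    rintro ⟨w, hw⟩
    obtain ⟨c, hc⟩ := hspan w hw v hv.1 hv.2
    exact ⟨c, Subtype.ext hc⟩
  · rintro u v ⟨hu, hu1⟩ ⟨hv, hv1⟩
    obtain ⟨c, hc⟩ := hspan v hv.1 u hu.1 hu.2
    have h1 : |c| = 1 := by
      rw [← hc, norm_smul, hu1, mul_one, Real.norm_eq_abs] at hv1
      exact hv1
    rcases (abs_eq zero_le_one).1 h1 with h | h
    · left; rw [← hc, h, one_smul]
    · right; rw [← hc, h, neg_smul, one_smul]
  · rintro u ⟨hu, hu1⟩
    set a := ⟪b, u⟫ with ha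
    set w := u - a • b with hw
    have hbb : ⟪b, b⟫ = 1 := by rw [real_inner_self_eq_norm_sq, hb, one_pow]
    have hbw : ⟪b, w⟫ = 0 := by
      rw [hw, inner_sub_right, real_inner_smul_right, hbb, ← ha]; ring
    have huw : u = a • b + w := by rw [hw]; abel
    have hwb : ⟪w, b⟫ = 0 := by rw [real_inner_comm]; exact hbw
    have hwu : ⟪w, u⟫ = ‖w‖ ^ 2 := by
      conv_lhs => rw [huw]
      rw [inner_add_right, real_inner_smul_right, hwb, real_inner_self_eq_norm_sq]
      ring
    have hw2 : ‖w‖ ^ 2 = 1 - a ^ 2 := by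
      rw [← hwu, hw, inner_sub_left, real_inner_smul_left, real_inner_self_eq_norm_sq, hu1, ← ha]
      ring
    have ha1 : |a| ≤ 1 := by
      have := abs_real_inner_le_norm b u
      rwa [hb, hu1, mul_one] at this
    -- The eigenvalue equation for `u = a b + w` is tested against `w`; since `1 - lam ≥ μ`, this
    -- bounds `‖w‖` by `ρ / (μ - β)`.
    have hkey : (1 - lam) * ‖w‖ ^ 2 ≤ ρ * ‖w‖ + β * ‖w‖ ^ 2 := by
      calc (1 - lam) * ‖w‖ ^ 2 = ⟪w, Matrix.toEuclideanLin M u⟫ := by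
            rw [hMx u hu.1, real_inner_smul_right, hwu]
        _ = a * ⟪w, Matrix.toEuclideanLin M b⟫ + ⟪w, Matrix.toEuclideanLin M w⟫ := by
            conv_lhs => rw [huw]
            rw [map_add, map_smul, inner_add_right, real_inner_smul_right]
        _ ≤ ρ * ‖w‖ + β * ‖w‖ ^ 2 := by
            refine add_le_add ?_ (hβ w hbw)
            refine (le_abs_self _).trans ?_
            rw [abs_mul]
            exact (mul_le_of_le_one_left (abs_nonneg _) ha1).trans (hρ w hbw)
    have hgap' : 0 < μ - β := by linarith
    have hwle : ‖w‖ ^ 2 ≤ (ρ / (μ - β)) ^ 2 := by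
      rcases eq_or_lt_of_le (norm_nonneg w) with h0 | h0
      · rw [← h0, zero_pow two_ne_zero]; exact sq_nonneg _
      · have h1 : (μ - β) * ‖w‖ ≤ ρ := by
          refine le_of_mul_le_mul_right ?_ h0
          nlinarith
        gcongr
        rw [le_div_iff₀ hgap']
        linarith
    have hdist : ∀ τ : ℝ, τ ^ 2 = 1 → ‖τ • u - b‖ ^ 2 = 2 - 2 * (τ * a) := by
      intro τ hτ
      rw [norm_sub_sq_real, norm_smul, mul_pow, hu1, hb, Real.norm_eq_abs, sq_abs, hτ,
        real_inner_smul_left, real_inner_comm, ← ha]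
      ring
    -- The sign is chosen so that `τ a = |a|`; then `2 - 2|a| ≤ 2(1 - a²) = 2‖w‖²`.
    rcases le_total 0 a with h | h
    · refine ⟨1, Or.inl rfl, ?_⟩
      rw [hdist 1 (by norm_num)]
      rw [abs_of_nonneg h] at ha1
      nlinarith
    · refine ⟨-1, Or.inr rfl, ?_⟩
      rw [hdist (-1) (by norm_num)]
      rw [abs_of_nonpos h] at ha1
      nlinarith

end Eigenvector

/-! ### Misclassified nodes -/

/-- A wrong sign at `i` forces `|v i - ū₁ i| ≥ 1/√(2k)`, so each misclassified node costs at least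
`1/(2k)` in squared distance. The value `v i = 0` is covered, whatever `sgn 0`. -/
theorem misclassified_le {k : ℕ} (v : EuclideanSpace ℝ (Fin (2 * k))) :
    (misclassified k v : ℝ) ≤ 2 * k * ‖v - uBar k‖ ^ 2 := by
  classical
  rcases Nat.eq_zero_or_pos k with h0 | hk
  · subst h0
    have : misclassified 0 v = 0 := by
      rw [misclassified, Set.ncard_eq_zero]
      exact Set.eq_empty_of_forall_notMem fun i => i.elim0
    simp [this]
  have hk' : (0 : ℝ) < 2 * k := by positivity
  have hs : 0 < √(2 * (k : ℝ)) := Real.sqrt_pos.2 hk'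
  have hi : ∀ i, sgn (v i) ≠ sgn (uBar k i) → 1 ≤ 2 * k * (v i - uBar k i) ^ 2 := by
    intro i h
    have hz : 2 * k * (1 / √(2 * (k : ℝ))) ^ 2 = 1 := by
      rw [div_pow, Real.sq_sqrt hk'.le]; field_simp
    rw [← hz]
    refine mul_le_mul_of_nonneg_left ?_ hk'.le
    have hpos : 0 < 1 / √(2 * (k : ℝ)) := by positivity
    rw [sq_le_sq, abs_of_pos hpos]
    simp only [uBar, sgn] at h ⊢
    split_ifs at h ⊢ with h1 h2 h3 h4 h5 h6 h7 <;> first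
      | exact absurd rfl h
      | (rw [neg_div] at *; rw [le_abs]; left; linarith)
      | (rw [le_abs]; right; linarith)
  rw [misclassified, Set.ncard_eq_toFinset_card', EuclideanSpace.real_norm_sq_eq, Finset.mul_sum]
  calc _ = ∑ i ∈ ({i | sgn (v i) ≠ sgn (uBar k i)} : Set (Fin (2 * k))).toFinset, (1 : ℝ) := by
        simp
    _ ≤ ∑ i ∈ ({i | sgn (v i) ≠ sgn (uBar k i)} : Set (Fin (2 * k))).toFinset,
        2 * k * (v i - uBar k i) ^ 2 :=
      Finset.sum_le_sum fun i h => hi i (by simpa using h)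
    _ ≤ ∑ i, 2 * k * (v i - uBar k i) ^ 2 :=
      Finset.sum_le_sum_of_subset_of_nonneg (Finset.subset_univ _) fun _ _ _ => by positivity
    _ = _ := by simp

theorem norm_uBar {k : ℕ} (hk : 0 < k) : ‖uBar k‖ = 1 := by
  have hk' : (0 : ℝ) < 2 * k := by positivity
  have : ‖uBar k‖ ^ 2 = 1 := by
    rw [EuclideanSpace.real_norm_sq_eq]
    have : ∀ i : Fin (2 * k), (uBar k).ofLp i ^ 2 = 1 / (2 * k) := by
      intro i
      simp only [uBar]
      rw [div_pow, Real.sq_sqrt hk'.le]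
      split_ifs <;> norm_num
    simp only [this, Finset.sum_const, Finset.card_univ, Fintype.card_fin, nsmul_eq_mul]
    push_cast
    field_simp
  nlinarith [norm_nonneg (uBar k)]

/-! ### Concentration in the signed inhomogeneous Erdős–Rényi model -/

section Concentration

open scoped Matrix.Norms.L2Operator

theorem exp_le_one_add_add_sq {x : ℝ} (hx : |x| ≤ 1) : Real.exp x ≤ 1 + x + x ^ 2 := by
  have := Real.abs_exp_sub_one_sub_id_le hx
  have := (abs_le.1 this).2
  linarith

section RowSums

variable {n : ℕ} {α : Type*} [Finite α] [MeasurableSpace α] [MeasurableSingletonClass α]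

/-- A Chernoff bound: at most `n` pairs meet node `i`, each with log-moment generating function at
most `lam² p`. The choice `lam = η/2` minimizes `lam² np - lam η np`. -/
theorem rowSum_tail (ν : NodePair n → Measure α) [∀ e, IsProbabilityMeasure (ν e)]
    (ξ : NodePair n → α → ℝ) {p η : ℝ} (hη0 : 0 ≤ η) (hη1 : η ≤ 1) (hp : 0 ≤ p)
    (h1 : ∀ e x, |ξ e x| ≤ 1)
    (hmean : ∀ e, ∫ x, ξ e x ∂ν e = 0) (hvar : ∀ e, ∫ x, ξ e x ^ 2 ∂ν e ≤ p) (i : Fin n) :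
    (Measure.pi ν).real {ω | η * (n * p) ≤ ∑ j, pairMatrix (fun e => ξ e (ω e)) i j} ≤
      Real.exp (-(η ^ 2 * (n * p) / 4)) := by
  set c : NodePair n → ℝ := fun e => (if e.1.1 = i then 1 else 0) + if e.1.2 = i then 1 else 0
    with hc
  have hc01 : ∀ e, c e = 0 ∨ c e = 1 := by
    intro e
    have := e.2.ne
    simp only [hc]
    split_ifs <;> simp_all
  have hrow : ∀ x : NodePair n → ℝ, ∑ j, pairMatrix x i j = ∑ e, c e * x e := by
    intro x
    have := bilinear_pairMatrix x (fun l => if l = i then 1 else 0) fun _ => 1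
    simp only [mul_one] at this
    rw [← this, Finset.sum_comm]
    refine Finset.sum_congr rfl fun j _ => ?_
    simp
  have hcsum : ∑ e, c e ≤ n := by
    have := sum_sum_eq_sum_nodePair fun l (_ : Fin n) => if l = i then (1 : ℝ) else 0
    simp at this
    rw [this]
    simp [hc]
  set lam := η / 2 with hlam
  have hmgf : ∀ e, ∫ x, Real.exp (lam * (c e * ξ e x)) ∂ν e ≤ Real.exp (lam ^ 2 * p * c e) := by
    intro e
    rcases hc01 e with h | h
    · simp [h]
    · simp only [h, one_mul, mul_one]
      calc ∫ x, Real.exp (lam * ξ e x) ∂ν e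
          ≤ ∫ x, (1 + lam * ξ e x + lam ^ 2 * ξ e x ^ 2) ∂ν e := by
            refine integral_mono Integrable.of_finite Integrable.of_finite fun x => ?_
            refine (exp_le_one_add_add_sq ?_).trans (by rw [mul_pow])
            rw [abs_mul]
            refine mul_le_one₀ ?_ (abs_nonneg _) (h1 e x)
            rw [abs_le]; constructor <;> linarith
        _ = 1 + lam ^ 2 * ∫ x, ξ e x ^ 2 ∂ν e := by
            rw [integral_add Integrable.of_finite Integrable.of_finite,
              integral_add Integrable.of_finite Integrable.of_finite, integral_const_mul,
              integral_const_mul, hmean]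
            simp
        _ ≤ 1 + lam ^ 2 * p := by gcongr; exact hvar e
        _ ≤ Real.exp (lam ^ 2 * p) := by
            have := Real.add_one_le_exp (lam ^ 2 * p)
            linarith
  have htot : ∫ ω, Real.exp (lam * ∑ j, pairMatrix (fun e => ξ e (ω e)) i j) ∂Measure.pi ν ≤
      Real.exp (lam ^ 2 * (n * p)) := by
    simp only [hrow, Finset.mul_sum, Real.exp_sum]
    rw [integral_fintype_prod_eq_prod (f := fun e x => Real.exp (lam * (c e * ξ e x)))]
    refine (Finset.prod_le_prod (fun _ _ => integral_nonneg fun _ => (Real.exp_pos _).le)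
      fun e _ => hmgf e).trans ?_
    rw [← Real.exp_sum, Real.exp_le_exp, ← Finset.mul_sum]
    have : 0 ≤ lam ^ 2 * p := by positivity
    nlinarith [mul_le_mul_of_nonneg_left hcsum this]
  have hmarkov := mul_meas_ge_le_integral_of_nonneg (μ := Measure.pi ν)
    (f := fun ω => Real.exp (lam * ∑ j, pairMatrix (fun e => ξ e (ω e)) i j))
    (ae_of_all _ fun ω => (Real.exp_pos _).le) Integrable.of_finite
    (Real.exp (lam * (η * (n * p))))
  have hsub : (Measure.pi ν).real {ω | η * (n * p) ≤ ∑ j, pairMatrix (fun e => ξ e (ω e)) i j} ≤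
      (Measure.pi ν).real {ω | Real.exp (lam * (η * (n * p))) ≤
        Real.exp (lam * ∑ j, pairMatrix (fun e => ξ e (ω e)) i j)} := by
    refine measureReal_mono fun ω hω => ?_
    simp only [Set.mem_ofPred_eq] at hω ⊢
    gcongr
  refine hsub.trans ?_
  have h3 := hmarkov.trans htot
  rw [mul_comm, ← le_div_iff₀ (Real.exp_pos _), ← Real.exp_sub] at h3
  refine h3.trans (le_of_eq ?_)
  rw [hlam]
  ring_nf

end RowSums

/-- The law of the coins of a pair. -/
noncomputable def coinMeasure (a b : unitInterval) : Measure (Bool × Bool) :=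
  (bernoulliMeasure true false a).prod (bernoulliMeasure true false b)

instance (a b : unitInterval) : IsProbabilityMeasure (coinMeasure a b) := by
  unfold coinMeasure; infer_instance

theorem integral_coinMeasure (a b : unitInterval) (f : Bool × Bool → ℝ) :
    ∫ x, f x ∂coinMeasure a b = a * (b * f (true, true) + (1 - b) * f (true, false)) +
      (1 - a) * (b * f (false, true) + (1 - b) * f (false, false)) := by
  rw [coinMeasure, integral_prod _ Integrable.of_finite]
  simp [integral_bernoulliMeasure]

theorem abs_entry (x : Bool × Bool) : |entry x| = if x.1 then 1 else 0 := by
  rcases x with ⟨_ | _, _ | _⟩ <;> (simp [entry]; try norm_num)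

theorem abs_adjacency {n : ℕ} (ω : Coins n) (i j : Fin n) :
    |adjacency ω i j| = pairMatrix (fun e => |entry (ω e)|) i j := by
  simp only [adjacency, pairMatrix, Matrix.of_apply]
  split_ifs <;> simp

theorem adjacency_eq_pairMatrix {n : ℕ} (ω : Coins n) :
    adjacency ω = pairMatrix fun e => entry (ω e) := rfl

/-- The expected signed adjacency matrix. -/
noncomputable def meanAdjacency {n : ℕ} (P S : Matrix (Fin n) (Fin n) unitInterval) :
    Matrix (Fin n) (Fin n) ℝ :=
  pairMatrix fun e => (P e.1.1 e.1.2 : ℝ) * (1 - 2 * S e.1.1 e.1.2)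

/-- The expected unsigned adjacency matrix. -/
noncomputable def meanAbsAdjacency {n : ℕ} (P : Matrix (Fin n) (Fin n) unitInterval) :
    Matrix (Fin n) (Fin n) ℝ :=
  pairMatrix fun e => (P e.1.1 e.1.2 : ℝ)

/-- The deviations of the adjacency matrices from their means are controlled. -/
def IsTypical {n : ℕ} (P S : Matrix (Fin n) (Fin n) unitInterval) (p η : ℝ) (ω : Coins n) : Prop :=
  ‖adjacency ω - meanAdjacency P S‖ ≤ 340 * √(n * p) ∧
    ‖(Matrix.of fun i j => |adjacency ω i j|) - meanAbsAdjacency P‖ ≤ 340 * √(n * p) ∧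
    ∀ i, |degree (adjacency ω) i - ∑ j, meanAbsAdjacency P i j| ≤ η * (n * p)

theorem not_isTypical_le {n : ℕ} (P S : Matrix (Fin n) (Fin n) unitInterval) {p η : ℝ}
    (hp0 : 0 < p) (hp1 : p ≤ 1) (hnp : 2 ≤ n * p) (hη0 : 0 ≤ η) (hη1 : η ≤ 1)
    (hP : ∀ i j, (P i j : ℝ) ≤ p) :
    (signedER P S).real {ω | ¬ IsTypical P S p η ω} ≤
      14 * n * Real.exp (-(η ^ 2 * (n * p) / 4)) := by
  set ν : NodePair n → Measure (Bool × Bool) :=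
    fun e => coinMeasure (P e.1.1 e.1.2) (S e.1.1 e.1.2) with hν
  have hpi : signedER P S = Measure.pi ν := rfl
  rw [hpi]
  -- The centered entry can exceed `1` in absolute value; halving it restores the bound required by
  -- `norm_pairMatrix_tail` and accounts for `340 = 2 · 170`.
  set ξ : NodePair n → Bool × Bool → ℝ :=
    fun e x => (entry x - P e.1.1 e.1.2 * (1 - 2 * S e.1.1 e.1.2)) / 2 with hξ
  set ζ : NodePair n → Bool × Bool → ℝ := fun e x => |entry x| - P e.1.1 e.1.2 with hζ
  have hPI : ∀ i j, (0 : ℝ) ≤ P i j ∧ (P i j : ℝ) ≤ 1 := fun i j => ⟨(P i j).2.1, (P i j).2.2⟩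
  have hSI : ∀ i j, (0 : ℝ) ≤ S i j ∧ (S i j : ℝ) ≤ 1 := fun i j => ⟨(S i j).2.1, (S i j).2.2⟩
  have hξ1 : ∀ e x, |ξ e x| ≤ 1 := by
    intro e x
    have h1 : |entry x| ≤ 1 := by rw [abs_entry]; split_ifs <;> norm_num
    have h2 : |(P e.1.1 e.1.2 : ℝ) * (1 - 2 * S e.1.1 e.1.2)| ≤ 1 := by
      rw [abs_mul]
      refine mul_le_one₀ ?_ (abs_nonneg _) ?_
      · rw [abs_of_nonneg (hPI _ _).1]; exact (hPI _ _).2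
      · have := hSI e.1.1 e.1.2
        rw [abs_le]; constructor <;> linarith
    simp only [hξ]
    rw [abs_le] at h1 h2 ⊢
    constructor <;> linarith
  have hζ1 : ∀ e x, |ζ e x| ≤ 1 := by
    intro e x
    have := hPI e.1.1 e.1.2
    simp only [hζ, abs_entry]
    rw [abs_le]
    split_ifs <;> constructor <;> linarith
  have hξm : ∀ e, ∫ x, ξ e x ∂ν e = 0 := by
    intro e
    simp only [hν, integral_coinMeasure, hξ, entry]
    norm_num
    ring
  have hζm : ∀ e, ∫ x, ζ e x ∂ν e = 0 := by
    intro e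
    simp only [hν, integral_coinMeasure, hζ, abs_entry]
    norm_num
    ring
  have hξv : ∀ e, ∫ x, ξ e x ^ 2 ∂ν e ≤ p := by
    intro e
    refine le_trans ?_ (hP e.1.1 e.1.2)
    simp only [hν, integral_coinMeasure, hξ, entry]
    norm_num
    have h := hPI e.1.1 e.1.2
    nlinarith [sq_nonneg ((P e.1.1 e.1.2 : ℝ) * (1 - 2 * S e.1.1 e.1.2))]
  have hζv : ∀ e, ∫ x, ζ e x ^ 2 ∂ν e ≤ p := by
    intro e
    refine le_trans ?_ (hP e.1.1 e.1.2)
    simp only [hν, integral_coinMeasure, hζ, abs_entry]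
    norm_num
    have h := hPI e.1.1 e.1.2
    nlinarith [sq_nonneg (P e.1.1 e.1.2 : ℝ)]
  have hnp0 : 0 ≤ n * p := by linarith
  have hexp : Real.exp (-(n * p / 4)) ≤ Real.exp (-(η ^ 2 * (n * p) / 4)) := by
    rw [Real.exp_le_exp]
    have : η ^ 2 ≤ 1 := pow_le_one₀ hη0 hη1
    nlinarith
  have hA := norm_pairMatrix_tail ν ξ hp0 hp1 hnp hξ1 hξm hξv
  have hB := norm_pairMatrix_tail ν ζ hp0 hp1 hnp hζ1 hζm hζv
  have hC := rowSum_tail ν ζ hη0 hη1 hp0.le hζ1 hζm hζv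
  have hD := rowSum_tail ν (fun e x => -ζ e x) hη0 hη1 hp0.le (by simpa using hζ1)
    (fun e => by rw [integral_neg, hζm, neg_zero]) (by simpa using hζv)
  have hneg : ∀ (x : NodePair n → ℝ) i j, pairMatrix (fun e => -x e) i j = -pairMatrix x i j := by
    intro x i j
    simp only [pairMatrix, Matrix.of_apply]
    split_ifs <;> simp
  have e1 : ∀ ω : Coins n, adjacency ω - meanAdjacency P S =
      (2 : ℝ) • pairMatrix fun e => ξ e (ω e) := by
    intro ω
    ext i j
    simp only [adjacency_eq_pairMatrix, meanAdjacency, pairMatrix, Matrix.sub_apply,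
      Matrix.smul_apply, Matrix.of_apply, hξ, smul_eq_mul]
    split_ifs <;> ring
  have e2 : ∀ ω : Coins n, (Matrix.of fun i j => |adjacency ω i j|) - meanAbsAdjacency P =
      pairMatrix fun e => ζ e (ω e) := by
    intro ω
    ext i j
    simp only [abs_adjacency, meanAbsAdjacency, pairMatrix, Matrix.sub_apply, Matrix.of_apply, hζ]
    split_ifs <;> ring
  have e3 : ∀ (ω : Coins n) i, degree (adjacency ω) i - ∑ j, meanAbsAdjacency P i j =
      ∑ j, pairMatrix (fun e => ζ e (ω e)) i j := by
    intro ω i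
    rw [← e2 ω, degree, ← Finset.sum_sub_distrib]
    rfl
  -- Two norm events cost `6n` each and the two one-sided degree events `n` each, which gives the
  -- factor `14n`.
  have hcover : {ω | ¬ IsTypical P S p η ω} ⊆
      {ω | 170 * √(n * p) ≤ ‖pairMatrix fun e => ξ e (ω e)‖} ∪
      ({ω | 170 * √(n * p) ≤ ‖pairMatrix fun e => ζ e (ω e)‖} ∪
      ((⋃ i, {ω | η * (n * p) ≤ ∑ j, pairMatrix (fun e => ζ e (ω e)) i j}) ∪
      ⋃ i, {ω | η * (n * p) ≤ ∑ j, pairMatrix (fun e => -ζ e (ω e)) i j})) := by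
    intro ω hω
    by_contra hcon
    simp only [Set.mem_union, Set.mem_ofPred_eq, Set.mem_iUnion, not_or, not_exists, not_le] at hcon
    obtain ⟨h1, h2, h3, h4⟩ := hcon
    refine hω ⟨?_, ?_, fun i => ?_⟩
    · rw [e1, norm_smul, Real.norm_eq_abs, abs_two]
      linarith
    · rw [e2]
      have := Real.sqrt_nonneg (n * p)
      linarith
    · have h4' := h4 i
      simp only [hneg, Finset.sum_neg_distrib] at h4'
      rw [e3, abs_le]
      constructor
      · linarith
      · exact (h3 i).le
  refine (measureReal_mono hcover).trans ?_
  refine (measureReal_union_le _ _).trans ?_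
  have hU1 : (Measure.pi ν).real
      (⋃ i, {ω | η * (n * p) ≤ ∑ j, pairMatrix (fun e => ζ e (ω e)) i j}) ≤
      n * Real.exp (-(η ^ 2 * (n * p) / 4)) := by
    refine (measureReal_iUnion_fintype_le _).trans ?_
    exact (Finset.sum_le_sum fun i _ => hC i).trans (by simp)
  have hU2 : (Measure.pi ν).real
      (⋃ i, {ω | η * (n * p) ≤ ∑ j, pairMatrix (fun e => -ζ e (ω e)) i j}) ≤
      n * Real.exp (-(η ^ 2 * (n * p) / 4)) := by
    refine (measureReal_iUnion_fintype_le _).trans ?_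
    exact (Finset.sum_le_sum fun i _ => hD i).trans (by simp)
  have hU := (measureReal_union_le (μ := Measure.pi ν)
    (⋃ i, {ω | η * (n * p) ≤ ∑ j, pairMatrix (fun e => ζ e (ω e)) i j})
    (⋃ i, {ω | η * (n * p) ≤ ∑ j, pairMatrix (fun e => -ζ e (ω e)) i j}))
  have hV := (measureReal_union_le (μ := Measure.pi ν)
    {ω | 170 * √(n * p) ≤ ‖pairMatrix fun e => ζ e (ω e)‖}
    ((⋃ i, {ω | η * (n * p) ≤ ∑ j, pairMatrix (fun e => ζ e (ω e)) i j}) ∪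
    ⋃ i, {ω | η * (n * p) ≤ ∑ j, pairMatrix (fun e => -ζ e (ω e)) i j}))
  have hn : (0 : ℝ) ≤ n := Nat.cast_nonneg n
  have hexp' := mul_le_mul_of_nonneg_left hexp (mul_nonneg (by norm_num : (0 : ℝ) ≤ 6) hn)
  linarith

end Concentration

/-! ### The normalized quadratic form around a rank-two mean -/

section QuadraticForm

open scoped Matrix.Norms.L2Operator RealInnerProductSpace

variable {n : ℕ}

theorem abs_sum_mul_le (f g : Fin n → ℝ) {F G : ℝ} (hF0 : 0 ≤ F) (hG0 : 0 ≤ G)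
    (hF : ∑ i, f i ^ 2 ≤ F ^ 2) (hG : ∑ i, g i ^ 2 ≤ G ^ 2) : |∑ i, f i * g i| ≤ F * G := by
  refine abs_le_of_sq_le_sq ?_ (mul_nonneg hF0 hG0)
  rw [mul_pow]
  exact (Finset.sum_mul_sq_le_sq_mul_sq _ _ _).trans
    (mul_le_mul hF hG (Finset.sum_nonneg fun _ _ => sq_nonneg _) (sq_nonneg _))

/-- The vector with coordinates `h i * x i`. -/
noncomputable def scale (h : Fin n → ℝ) (x : EuclideanSpace ℝ (Fin n)) :
    EuclideanSpace ℝ (Fin n) := WithLp.toLp 2 fun i => h i * x i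

theorem inner_conj_diagonal (h : Fin n → ℝ) (A : Matrix (Fin n) (Fin n) ℝ)
    (x y : EuclideanSpace ℝ (Fin n)) :
    ⟪x, Matrix.toEuclideanLin (Matrix.diagonal h * A * Matrix.diagonal h) y⟫ =
      (scale h x).ofLp ⬝ᵥ A.mulVec (scale h y).ofLp := by
  rw [← Matrix.coe_toEuclideanCLM_eq_toEuclideanLin, ContinuousLinearMap.coe_coe,
    Matrix.inner_toEuclideanCLM]
  simp only [dotProduct, Matrix.mulVec, Matrix.mul_diagonal, Matrix.diagonal_mul, scale,
    Finset.mul_sum]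
  exact Finset.sum_congr rfl fun i _ => Finset.sum_congr rfl fun j _ => by ring

theorem dotProduct_mulVec_decomp {A : Matrix (Fin n) (Fin n) ℝ} (R : Matrix (Fin n) (Fin n) ℝ)
    {σ : Fin n → ℝ} {a b c : ℝ}
    (hA : ∀ i j, A i j - R i j = a * (σ i * σ j) + b - if i = j then c else 0) (x y : Fin n → ℝ) :
    x ⬝ᵥ A.mulVec y = x ⬝ᵥ R.mulVec y + a * ((∑ i, σ i * x i) * ∑ i, σ i * y i) +
      b * ((∑ i, x i) * ∑ i, y i) - c * ∑ i, x i * y i := by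
  have hA' : ∀ i j, A i j = R i j + (a * (σ i * σ j) + b - if i = j then c else 0) := by
    intro i j; rw [← hA]; ring
  have h4 : c * ∑ i, x i * y i = ∑ i, ∑ j, x i * ((if i = j then c else 0) * y j) := by
    rw [Finset.mul_sum]
    refine Finset.sum_congr rfl fun i _ => ?_
    rw [Finset.sum_eq_single i]
    · simp; ring
    · intro j _ hj
      simp [hj.symm]
    · simp
  rw [h4, Finset.sum_mul_sum, Finset.sum_mul_sum]
  simp only [dotProduct, Matrix.mulVec, hA', Finset.mul_sum, ← Finset.sum_add_distrib,
    ← Finset.sum_sub_distrib]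
  exact Finset.sum_congr rfl fun i _ => Finset.sum_congr rfl fun j _ => by ring

/-- Rests on `x - d = (√x - √d)(√x + √d)`. The bound is linear in `x - d`, so square-summed degree
deviations pass to `D^{-1/2}`. -/
theorem abs_inv_sqrt_sub_le {x d Δ : ℝ} (hd : 0 < d) (hx : 0 < x) (hΔ : (√x)⁻¹ ≤ Δ) :
    |(√x)⁻¹ - (√d)⁻¹| ≤ Δ * (|x - d| / d) := by
  have hsx := Real.sqrt_pos.2 hx
  have hsd := Real.sqrt_pos.2 hd
  have h1 : (√x)⁻¹ - (√d)⁻¹ = (√x)⁻¹ * ((√d - √x) / √d) := by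
    field_simp
  have h2 : |√d - √x| * √d ≤ |x - d| := by
    have h3 : x - d = (√x - √d) * (√x + √d) := by
      have e1 := Real.mul_self_sqrt hx.le
      have e2 := Real.mul_self_sqrt hd.le
      linarith [mul_comm (√x) (√d)]
    rw [h3, abs_mul, abs_sub_comm, abs_of_pos (add_pos hsx hsd)]
    gcongr
    linarith
  rw [h1, abs_mul, abs_of_pos (inv_pos.2 hsx), abs_div, abs_of_pos hsd]
  have hΔ0 : 0 ≤ Δ := (inv_pos.2 hsx).le.trans hΔ
  gcongr ?_ * ?_
  rw [div_le_div_iff₀ hsd hd]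
  calc |√d - √x| * d = |√d - √x| * √d * √d := by rw [mul_assoc, Real.mul_self_sqrt hd.le]
    _ ≤ |x - d| * √d := by gcongr

/-- Bounds for the quadratic form of `D^{-1/2} A D^{-1/2}` when `A` is close to a matrix with
leading eigenvector `b₁ = σ / √n` and the degrees are nearly constant. -/
theorem normalized_form_bounds [NeZero n] {A R : Matrix (Fin n) (Fin n) ℝ} {σ δ : Fin n → ℝ}
    {a b c d η E : ℝ} {b₁ : EuclideanSpace ℝ (Fin n)}
    (hσ : ∀ i, σ i ^ 2 = 1) (hσ0 : ∑ i, σ i = 0) (hb₁ : ∀ i, b₁ i = σ i / √n)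
    (ha : 0 ≤ a) (hb : 0 ≤ b) (hc : 0 ≤ c) (hd : 0 < d) (hη1 : η < 1)
    (hE : 0 ≤ E)
    (hA : ∀ i j, A i j - R i j = a * (σ i * σ j) + b - if i = j then c else 0)
    (hR : ‖R‖ ≤ E) (hδ : ∀ i, |δ i - d| ≤ η * d) (hδ2 : ∑ i, (δ i - d) ^ 2 ≤ n * E ^ 2) :
    a * n / ((1 + η) * d) - (c + E) * (1 / ((1 - η) * d)) ≤
        ⟪b₁, Matrix.toEuclideanLin (Matrix.diagonal (fun i => (√(δ i))⁻¹) * A *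
          Matrix.diagonal fun i => (√(δ i))⁻¹) b₁⟫ ∧
      (∀ w, ⟪b₁, w⟫ = 0 → ⟪w, Matrix.toEuclideanLin (Matrix.diagonal (fun i => (√(δ i))⁻¹) * A *
          Matrix.diagonal fun i => (√(δ i))⁻¹) w⟫ ≤
        1 / ((1 - η) * d) * (a * n * (E / d) ^ 2 + b * n + E) * ‖w‖ ^ 2) ∧
      ∀ w, ⟪b₁, w⟫ = 0 → |⟪w, Matrix.toEuclideanLin (Matrix.diagonal (fun i => (√(δ i))⁻¹) * A *
          Matrix.diagonal fun i => (√(δ i))⁻¹) b₁⟫| ≤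
        1 / ((1 - η) * d) * (E + (a + b) * n * (E / d) + c) * ‖w‖ := by
  set h : Fin n → ℝ := fun i => (√(δ i))⁻¹ with hh
  set Δ := 1 / ((1 - η) * d) with hΔ
  have hηd : 0 < (1 - η) * d := mul_pos (by linarith) hd
  have hΔ0 : 0 < Δ := by rw [hΔ]; positivity
  have hn : (0 : ℝ) < n := by exact_mod_cast Nat.pos_of_ne_zero (NeZero.ne n)
  have hsn : 0 < √(n : ℝ) := Real.sqrt_pos.2 hn
  have hsΔ : 0 < √Δ := Real.sqrt_pos.2 hΔ0
  have hδl : ∀ i, (1 - η) * d ≤ δ i := fun i => by have := (abs_le.1 (hδ i)).1; linarith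
  have hδu : ∀ i, δ i ≤ (1 + η) * d := fun i => by have := (abs_le.1 (hδ i)).2; linarith
  have hδ0 : ∀ i, 0 < δ i := fun i => hηd.trans_le (hδl i)
  have hh0 : ∀ i, 0 < h i := fun i => inv_pos.2 (Real.sqrt_pos.2 (hδ0 i))
  have hhΔ : ∀ i, h i ≤ √Δ := by
    intro i
    simp only [hh]
    rw [← Real.sqrt_inv]
    refine Real.sqrt_le_sqrt ?_
    rw [hΔ, one_div]
    exact inv_anti₀ hηd (hδl i)
  have hhsq : ∀ i, h i ^ 2 ≤ Δ := by
    intro i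
    rw [← Real.sq_sqrt hΔ0.le]
    exact pow_le_pow_left₀ (hh0 i).le (hhΔ i) 2
  set e := fun i => h i - (√d)⁻¹ with he
  -- The fluctuation of `D^{-1/2}` is measured in `ℓ²`, giving relative size `E/d` rather than the
  -- much cruder uniform `η`. The convergence rate comes from here.
  have hesum : ∑ i, e i ^ 2 ≤ (√(n * Δ) * (E / d)) ^ 2 := by
    rw [mul_pow, Real.sq_sqrt (by positivity)]
    calc ∑ i, e i ^ 2 ≤ ∑ i, Δ * ((δ i - d) ^ 2 / d ^ 2) := by
          refine Finset.sum_le_sum fun i _ => ?_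
          have := abs_inv_sqrt_sub_le hd (hδ0 i) (hhΔ i)
          have h2 := pow_le_pow_left₀ (abs_nonneg _) this 2
          rwa [sq_abs, mul_pow, Real.sq_sqrt hΔ0.le, div_pow, sq_abs] at h2
      _ = Δ * ((∑ i, (δ i - d) ^ 2) / d ^ 2) := by rw [← Finset.mul_sum, ← Finset.sum_div]
      _ ≤ Δ * ((n * E ^ 2) / d ^ 2) := by gcongr
      _ = _ := by ring
  have hcoord : ∀ x : EuclideanSpace ℝ (Fin n), ∑ i, x i ^ 2 ≤ ‖x‖ ^ 2 := fun x =>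
    (EuclideanSpace.real_norm_sq_eq x).ge
  have hscale : ∀ x, ‖scale h x‖ ≤ √Δ * ‖x‖ := by
    intro x
    refine (sq_le_sq₀ (norm_nonneg _) (by positivity)).1 ?_
    rw [mul_pow, Real.sq_sqrt hΔ0.le, EuclideanSpace.real_norm_sq_eq,
      EuclideanSpace.real_norm_sq_eq, Finset.mul_sum]
    refine Finset.sum_le_sum fun i _ => ?_
    simp only [scale, mul_pow]
    exact mul_le_mul_of_nonneg_right (hhsq i) (sq_nonneg _)
  have hr0 : 0 ≤ √(n * Δ) := Real.sqrt_nonneg _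
  have hrr : √(n * Δ) * √(n * Δ) = n * Δ := Real.mul_self_sqrt (by positivity)
  have hsumh : ∑ i, h i ^ 2 ≤ √(n * Δ) ^ 2 := by
    rw [Real.sq_sqrt (by positivity)]
    exact (Finset.sum_le_sum fun i _ => hhsq i).trans (by simp)
  have hsumσh : ∑ i, (σ i * h i) ^ 2 ≤ √(n * Δ) ^ 2 := by
    simp only [mul_pow, hσ, one_mul]
    exact hsumh
  have hS1 : ∀ x : EuclideanSpace ℝ (Fin n), |∑ i, (scale h x).ofLp i| ≤ √(n * Δ) * ‖x‖ :=
    fun x => abs_sum_mul_le h x.ofLp hr0 (norm_nonneg _) hsumh (hcoord x)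
  have hS2 : ∀ x : EuclideanSpace ℝ (Fin n),
      |∑ i, σ i * (scale h x).ofLp i| ≤ √(n * Δ) * ‖x‖ := by
    intro x
    have := abs_sum_mul_le (fun i => σ i * h i) x.ofLp hr0 (norm_nonneg _) hsumσh (hcoord x)
    simpa only [scale, mul_assoc] using this
  have hEd : 0 ≤ E / d := by positivity
  -- For `x ⊥ b₁` the constant part `(√d)⁻¹` of the scaling drops out, leaving only the small
  -- fluctuation `e`. The same happens for `b₁` against the all-ones vector, because `∑ σ i = 0`.
  have hS3 : ∀ x, ⟪b₁, x⟫ = 0 →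
      |∑ i, σ i * (scale h x).ofLp i| ≤ √(n * Δ) * (E / d) * ‖x‖ := by
    intro x hx
    have hx' : ∑ i, σ i * x i = 0 := by
      have h1 : ⟪b₁, x⟫ = (∑ i, σ i * x i) / √n := by
        rw [PiLp.inner_apply, Finset.sum_div]
        refine Finset.sum_congr rfl fun i _ => ?_
        rw [hb₁]
        simp
        ring
      rw [h1, div_eq_zero_iff] at hx
      exact hx.resolve_right hsn.ne'
    have h2 : ∑ i, σ i * (scale h x).ofLp i = ∑ i, σ i * e i * x i := by
      have : ∑ i, σ i * e i * x i =
          ∑ i, σ i * (scale h x).ofLp i - (√d)⁻¹ * ∑ i, σ i * x i := by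
        rw [Finset.mul_sum, ← Finset.sum_sub_distrib]
        refine Finset.sum_congr rfl fun i _ => ?_
        simp only [he, scale]
        ring
      rw [this, hx', mul_zero, sub_zero]
    rw [h2]
    refine abs_sum_mul_le (fun i => σ i * e i) x.ofLp (by positivity) (norm_nonneg _) ?_ (hcoord x)
    simpa only [mul_pow, hσ, one_mul] using hesum
  have hb₁n : ‖b₁‖ = 1 := by
    have : ‖b₁‖ ^ 2 = 1 := by
      rw [EuclideanSpace.real_norm_sq_eq]
      simp only [hb₁, div_pow, hσ, Real.sq_sqrt hn.le, Finset.sum_const, Finset.card_univ,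
        Fintype.card_fin, nsmul_eq_mul]
      field_simp
    nlinarith [norm_nonneg b₁]
  have hS4 : |∑ i, (scale h b₁).ofLp i| ≤ √(n * Δ) * (E / d) := by
    have h2 : ∑ i, (scale h b₁).ofLp i = ∑ i, e i * b₁ i := by
      have : ∑ i, e i * b₁ i = ∑ i, (scale h b₁).ofLp i - (√d)⁻¹ / √n * ∑ i, σ i := by
        rw [Finset.mul_sum, ← Finset.sum_sub_distrib]
        refine Finset.sum_congr rfl fun i _ => ?_
        simp only [he, scale, hb₁]
        ring
      rw [this, hσ0, mul_zero, sub_zero]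
    rw [h2, ← mul_one (√(n * Δ) * (E / d)), ← hb₁n]
    exact abs_sum_mul_le e b₁.ofLp (by positivity) (norm_nonneg _) hesum (hcoord b₁)
  have hS5 : n / ((1 + η) * d) ≤ (∑ i, σ i * (scale h b₁).ofLp i) ^ 2 := by
    have hη' : 0 < (1 + η) * d := (hδ0 0).trans_le (hδu 0)
    have h1 : ∀ i, (√((1 + η) * d))⁻¹ / √n ≤ σ i * (scale h b₁).ofLp i := by
      intro i
      have : σ i * (scale h b₁).ofLp i = σ i ^ 2 * (h i / √n) := by
        simp only [scale, hb₁]; ring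
      rw [this, hσ, one_mul]
      gcongr
      exact inv_anti₀ (Real.sqrt_pos.2 (hδ0 i)) (Real.sqrt_le_sqrt (hδu i))
    have h2 := Finset.sum_le_sum fun i (_ : i ∈ Finset.univ) => h1 i
    rw [Finset.sum_const, Finset.card_univ, Fintype.card_fin, nsmul_eq_mul] at h2
    have h3 : n / ((1 + η) * d) = (n * ((√((1 + η) * d))⁻¹ / √n)) ^ 2 := by
      rw [mul_pow, div_pow, inv_pow, Real.sq_sqrt hη'.le, Real.sq_sqrt hn.le]
      field_simp
    rw [h3]
    exact pow_le_pow_left₀ (by positivity) h2 2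
  have hRb : ∀ x y : EuclideanSpace ℝ (Fin n),
      |(scale h x).ofLp ⬝ᵥ R.mulVec (scale h y).ofLp| ≤ E * Δ * (‖x‖ * ‖y‖) := by
    intro x y
    refine (sum_mul_mul_le_norm R _ _).trans ?_
    calc ‖R‖ * ‖scale h x‖ * ‖scale h y‖ ≤ E * (√Δ * ‖x‖) * (√Δ * ‖y‖) := by
          gcongr
          · exact hscale x
          · exact hscale y
      _ = E * (√Δ * √Δ) * (‖x‖ * ‖y‖) := by ring
      _ = _ := by rw [Real.mul_self_sqrt hΔ0.le]
  have hdot : ∀ x y : EuclideanSpace ℝ (Fin n),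
      |∑ i, (scale h x).ofLp i * (scale h y).ofLp i| ≤ Δ * (‖x‖ * ‖y‖) := by
    intro x y
    refine (abs_sum_mul_le _ _ (norm_nonneg (scale h x)) (norm_nonneg (scale h y)) (hcoord _)
      (hcoord _)).trans ?_
    calc ‖scale h x‖ * ‖scale h y‖ ≤ (√Δ * ‖x‖) * (√Δ * ‖y‖) :=
          mul_le_mul (hscale x) (hscale y) (norm_nonneg _) (by positivity)
      _ = (√Δ * √Δ) * (‖x‖ * ‖y‖) := by ring
      _ = _ := by rw [Real.mul_self_sqrt hΔ0.le]
  have hform : ∀ x y, ⟪x, Matrix.toEuclideanLin (Matrix.diagonal h * A * Matrix.diagonal h) y⟫ =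
      (scale h x).ofLp ⬝ᵥ R.mulVec (scale h y).ofLp +
        a * ((∑ i, σ i * (scale h x).ofLp i) * ∑ i, σ i * (scale h y).ofLp i) +
        b * ((∑ i, (scale h x).ofLp i) * ∑ i, (scale h y).ofLp i) -
        c * ∑ i, (scale h x).ofLp i * (scale h y).ofLp i := fun x y => by
    rw [inner_conj_diagonal, dotProduct_mulVec_decomp R hA]
  -- Signs allow terms to be discarded: the `b` term is nonnegative in the lower bound, and the `-c`
  -- term is nonpositive in the upper bound.
  refine ⟨?_, fun w hw => ?_, fun w hw => ?_⟩
  · rw [hform]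
    have h1 := (abs_le.1 (hRb b₁ b₁)).1
    have h2 := (abs_le.1 (hdot b₁ b₁)).2
    rw [hb₁n, mul_one, mul_one] at h1 h2
    have h3 : a * n / ((1 + η) * d) ≤
        a * ((∑ i, σ i * (scale h b₁).ofLp i) * ∑ i, σ i * (scale h b₁).ofLp i) := by
      rw [mul_div_assoc, ← sq]
      gcongr
    have h4 : 0 ≤ b * ((∑ i, (scale h b₁).ofLp i) * ∑ i, (scale h b₁).ofLp i) :=
      mul_nonneg hb (mul_self_nonneg _)
    have h5 := mul_le_mul_of_nonneg_left h2 hc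
    linarith
  · rw [hform]
    have h1 := (abs_le.1 (hRb w w)).2
    have h3 : a * ((∑ i, σ i * (scale h w).ofLp i) * ∑ i, σ i * (scale h w).ofLp i) ≤
        a * (n * Δ * (E / d) ^ 2 * ‖w‖ ^ 2) := by
      refine mul_le_mul_of_nonneg_left ?_ ha
      rw [← sq, ← sq_abs]
      refine (pow_le_pow_left₀ (abs_nonneg _) (hS3 w hw) 2).trans (le_of_eq ?_)
      rw [mul_pow, mul_pow, Real.sq_sqrt (by positivity)]
    have h4 : b * ((∑ i, (scale h w).ofLp i) * ∑ i, (scale h w).ofLp i) ≤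
        b * (n * Δ * ‖w‖ ^ 2) := by
      refine mul_le_mul_of_nonneg_left ?_ hb
      rw [← sq, ← sq_abs]
      refine (pow_le_pow_left₀ (abs_nonneg _) (hS1 w) 2).trans (le_of_eq ?_)
      rw [mul_pow, Real.sq_sqrt (by positivity)]
    have h5 : 0 ≤ c * ∑ i, (scale h w).ofLp i * (scale h w).ofLp i :=
      mul_nonneg hc (Finset.sum_nonneg fun _ _ => mul_self_nonneg _)
    calc _ ≤ E * Δ * (‖w‖ * ‖w‖) + a * (n * Δ * (E / d) ^ 2 * ‖w‖ ^ 2) +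
          b * (n * Δ * ‖w‖ ^ 2) := by linarith
      _ = _ := by ring
  · rw [hform]
    have h1 := hRb w b₁
    have h2 := hdot w b₁
    rw [hb₁n, mul_one] at h1 h2
    have h3 : |a * ((∑ i, σ i * (scale h w).ofLp i) * ∑ i, σ i * (scale h b₁).ofLp i)| ≤
        a * ((√(n * Δ) * (E / d) * ‖w‖) * √(n * Δ)) := by
      rw [abs_mul, abs_mul, abs_of_nonneg ha]
      have h6 := hS2 b₁
      rw [hb₁n, mul_one] at h6
      gcongr
      exact hS3 w hw
    have h4 : |b * ((∑ i, (scale h w).ofLp i) * ∑ i, (scale h b₁).ofLp i)| ≤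
        b * ((√(n * Δ) * ‖w‖) * (√(n * Δ) * (E / d))) := by
      rw [abs_mul, abs_mul, abs_of_nonneg hb]
      gcongr
      exact hS1 w
    have h5 : |c * ∑ i, (scale h w).ofLp i * (scale h b₁).ofLp i| ≤ c * (Δ * ‖w‖) := by
      rw [abs_mul, abs_of_nonneg hc]
      gcongr
    calc _ ≤ E * Δ * ‖w‖ + a * ((√(n * Δ) * (E / d) * ‖w‖) * √(n * Δ)) +
          b * ((√(n * Δ) * ‖w‖) * (√(n * Δ) * (E / d))) + c * (Δ * ‖w‖) := by
          rw [abs_le] at h1 h3 h4 h5 ⊢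
          constructor <;> linarith [h1.1, h1.2, h3.1, h3.2, h4.1, h4.2, h5.1, h5.2]
      _ = E * Δ * ‖w‖ + (a + b) * (√(n * Δ) * √(n * Δ)) * (E / d) * ‖w‖ + c * (Δ * ‖w‖) := by ring
      _ = _ := by rw [hrr]; ring

end QuadraticForm

/-! ### The bisection model -/

section Bisection

open scoped Matrix.Norms.L2Operator RealInnerProductSpace

/-- The signed indicator of the communities. -/
def communitySign (k : ℕ) (i : Fin (2 * k)) : ℝ := if (i : ℕ) < k then 1 else -1

theorem communitySign_sq (k : ℕ) (i : Fin (2 * k)) : communitySign k i ^ 2 = 1 := by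
  unfold communitySign; split_ifs <;> norm_num

theorem sum_communitySign (k : ℕ) : ∑ i, communitySign k i = 0 := by
  unfold communitySign
  rw [Fin.sum_univ_eq_sum_range (fun i => if i < k then (1 : ℝ) else -1), two_mul,
    Finset.sum_range_add, Finset.sum_congr rfl fun i hi => if_pos (Finset.mem_range.1 hi)]
  simp

/-- The matrix of edge probabilities. -/
noncomputable abbrev edgeProb (k : ℕ) (p q : unitInterval) :
    Matrix (Fin (2 * k)) (Fin (2 * k)) unitInterval := blockExtend (community k) !![p, q; q, p]

/-- The matrix of sign probabilities. -/
noncomputable abbrev signProb (k : ℕ) (s : unitInterval) :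
    Matrix (Fin (2 * k)) (Fin (2 * k)) unitInterval :=
  blockExtend (community k) !![s, unitInterval.symm s; unitInterval.symm s, s]

theorem edgeProb_le {k : ℕ} {p q : unitInterval} (hqp : q ≤ p) (i j : Fin (2 * k)) :
    (edgeProb k p q i j : ℝ) ≤ p := by
  have hqp' : (q : ℝ) ≤ p := hqp
  have := p.2.1
  simp only [edgeProb, blockExtend, Matrix.of_apply, community]
  split_ifs <;> simp [hqp', this]

theorem meanAbsAdjacency_edgeProb (k : ℕ) (p q : unitInterval) (i j : Fin (2 * k)) :
    meanAbsAdjacency (edgeProb k p q) i j =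
      (p - q) / 2 * (communitySign k i * communitySign k j) + (p + q) / 2 -
        if i = j then (p : ℝ) else 0 := by
  simp only [meanAbsAdjacency, pairMatrix, edgeProb, blockExtend, Matrix.of_apply, community,
    communitySign]
  rcases lt_trichotomy i j with h | h | h
  · simp only [h, h.ne, h.not_gt, dite_true, if_false]
    split_ifs <;> simp <;> ring
  · subst h
    simp only [lt_irrefl, dite_false, if_true]
    split_ifs <;> ring
  · simp only [h, h.ne, h.ne', h.not_gt, dite_true, dite_false, if_false]
    split_ifs <;> simp <;> ring

/-- Flipping the sign bias across communities exchanges the roles of `p + q` and `p - q`: the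
dominant direction is `σ` here, whereas it is constant for the unsigned mean. The last term corrects
the zero diagonal. -/
theorem meanAdjacency_edgeProb (k : ℕ) (p q s : unitInterval) (i j : Fin (2 * k)) :
    meanAdjacency (edgeProb k p q) (signProb k s) i j =
      (1 - 2 * s) * ((p + q) / 2) * (communitySign k i * communitySign k j) +
        (1 - 2 * s) * ((p - q) / 2) - if i = j then (1 - 2 * s) * (p : ℝ) else 0 := by
  simp only [meanAdjacency, pairMatrix, edgeProb, signProb, blockExtend, Matrix.of_apply, community,
    communitySign]
  rcases lt_trichotomy i j with h | h | h
  · simp only [h, h.ne, h.not_gt, dite_true, if_false]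
    split_ifs <;> simp <;> ring
  · subst h
    simp only [lt_irrefl, dite_false, if_true]
    split_ifs <;> ring
  · simp only [h, h.ne, h.ne', h.not_gt, dite_true, dite_false, if_false]
    split_ifs <;> simp <;> ring

theorem sum_meanAbsAdjacency (k : ℕ) (p q : unitInterval) (i : Fin (2 * k)) :
    ∑ j, meanAbsAdjacency (edgeProb k p q) i j = k * (p + q) - p := by
  simp only [meanAbsAdjacency_edgeProb, Finset.sum_sub_distrib, Finset.sum_add_distrib,
    ← Finset.mul_sum, sum_communitySign]
  simp
  ring

theorem normLaplacian_eq_one_sub {n : ℕ} {A : Matrix (Fin n) (Fin n) ℝ}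
    (hA : ∀ i, 0 < degree A i) :
    normLaplacian A = 1 - Matrix.diagonal (fun i => (√(degree A i))⁻¹) * A *
      Matrix.diagonal fun i => (√(degree A i))⁻¹ := by
  rw [normLaplacian, invSqrtDegree, Matrix.mul_sub, Matrix.sub_mul, Matrix.diagonal_mul_diagonal,
    Matrix.diagonal_mul_diagonal, ← Matrix.diagonal_one]
  congr 2
  ext i
  have h := Real.sqrt_pos.2 (hA i)
  have h2 := Real.mul_self_sqrt (hA i).le
  nth_rewrite 2 [← h2]
  field_simp

/-- The row sums are `B` applied to the all-ones vector, whose squared norm is `n`. -/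
theorem sum_sq_rowSum_le {n : ℕ} (B : Matrix (Fin n) (Fin n) ℝ) :
    ∑ i, (∑ j, B i j) ^ 2 ≤ n * ‖B‖ ^ 2 := by
  have h := norm_toEuclideanCLM_apply_le B (WithLp.toLp 2 fun _ => 1)
  have h2 := pow_le_pow_left₀ (norm_nonneg _) h 2
  rw [mul_pow, EuclideanSpace.real_norm_sq_eq, EuclideanSpace.real_norm_sq_eq] at h2
  simp [Matrix.mulVec, dotProduct] at h2
  linarith

theorem adjacency_comm {n : ℕ} (ω : Coins n) (i j : Fin n) :
    adjacency ω i j = adjacency ω j i := pairMatrix_comm (fun e => entry (ω e)) i j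

/-- For a typical outcome, the first eigenvector of the normalized Laplacian is close to `uBar`,
provided that there is a spectral gap. -/
theorem IsTypical.eigenvector_bound {k : ℕ} (hk : 0 < k) {p q s : unitInterval} (hqp : q ≤ p)
    (hs : (s : ℝ) ≤ 1 / 2) {d η η' E μ β ρ : ℝ} (hd : d = k * (p + q) - p) (hd0 : 0 < d)
    (hη1 : η < 1) (hη' : η' * (2 * k * p) ≤ η * d) (hE : E = 340 * √(2 * k * p)) {ω : Coins (2 * k)}
    (hω : IsTypical (edgeProb k p q) (signProb k s) p η' ω)
    (hμ : μ = (1 - 2 * s) * (k * (p + q)) / ((1 + η) * d) -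
      ((1 - 2 * s) * p + E) * (1 / ((1 - η) * d)))
    (hβ : β = 1 / ((1 - η) * d) * ((1 - 2 * s) * (k * (p + q)) * (E / d) ^ 2 +
      (1 - 2 * s) * (k * (p - q)) + E))
    (hρ : ρ = 1 / ((1 - η) * d) * (E + (1 - 2 * s) * (2 * k * p) * (E / d) + (1 - 2 * s) * p))
    (hgap : β < μ) :
    LambdaOneSimple (normLaplacian (adjacency ω)) ∧
      (∀ u v, IsUnitEigenvectorOne (normLaplacian (adjacency ω)) u →
        IsUnitEigenvectorOne (normLaplacian (adjacency ω)) v → v = u ∨ v = -u) ∧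
      ∀ u, IsUnitEigenvectorOne (normLaplacian (adjacency ω)) u →
        ∃ τ : ℝ, (τ = 1 ∨ τ = -1) ∧ ‖τ • u - uBar k‖ ^ 2 ≤ 2 * (ρ / (μ - β)) ^ 2 := by
  have : NeZero (2 * k) := ⟨by omega⟩
  have hp0 : (0 : ℝ) ≤ p := p.2.1
  have hq0 : (0 : ℝ) ≤ q := q.2.1
  have hqp' : (q : ℝ) ≤ p := hqp
  have hs' : 0 ≤ 1 - 2 * (s : ℝ) := by linarith
  obtain ⟨h1, h2, h3⟩ := hω
  push_cast at h1 h2 h3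
  rw [← hE] at h1 h2
  have hE0 : 0 ≤ E := by rw [hE]; positivity
  simp only [sum_meanAbsAdjacency, ← hd] at h3
  have hδ : ∀ i, |degree (adjacency ω) i - d| ≤ η * d := fun i => (h3 i).trans hη'
  have hδ0 : ∀ i, 0 < degree (adjacency ω) i := by
    intro i
    have := (abs_le.1 (hδ i)).1
    nlinarith
  have hδ2 : ∑ i, (degree (adjacency ω) i - d) ^ 2 ≤ (2 * k : ℕ) * E ^ 2 := by
    have h4 := sum_sq_rowSum_le
      ((Matrix.of fun i j => |adjacency ω i j|) - meanAbsAdjacency (edgeProb k p q))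
    simp only [Matrix.sub_apply, Finset.sum_sub_distrib, sum_meanAbsAdjacency, ← hd] at h4
    refine h4.trans ?_
    gcongr
  have hform := normalized_form_bounds (A := adjacency ω)
    (R := adjacency ω - meanAdjacency (edgeProb k p q) (signProb k s)) (σ := communitySign k)
    (δ := degree (adjacency ω)) (a := (1 - 2 * s) * ((p + q) / 2))
    (b := (1 - 2 * s) * ((p - q) / 2)) (c := (1 - 2 * s) * p) (d := d) (η := η) (E := E)
    (b₁ := uBar k) (communitySign_sq k) (sum_communitySign k)
    (fun i => by simp [uBar, communitySign]) (by positivity)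
    (mul_nonneg hs' (by linarith)) (by positivity) hd0 hη1 hE0
    (fun i j => by rw [Matrix.sub_apply, sub_sub_cancel, meanAdjacency_edgeProb])
    h1 hδ hδ2
  obtain ⟨f1, f2, f3⟩ := hform
  rw [normLaplacian_eq_one_sub hδ0]
  refine first_eigenvector_perturbation (fun i j => ?_) (norm_uBar hk) hgap
    (le_trans (le_of_eq ?_) f1) (fun w hw => (f2 w hw).trans (le_of_eq ?_))
    (fun w hw => (f3 w hw).trans (le_of_eq ?_))
  · simp only [Matrix.mul_diagonal, Matrix.diagonal_mul]
    rw [adjacency_comm ω i j]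
    ring
  · rw [hμ]; push_cast; ring
  · rw [hβ]; push_cast; ring
  · rw [hρ]; push_cast; ring

end Bisection

/-! ### Asymptotics in the dense setting -/

/-- The spectral gap and the residual in the dense setting, with `z = k^{1/4}`. -/
theorem dense_gap {γ₁ γ₂ s : ℝ} (hγ₂ : 0 < γ₂) (hγ : γ₂ < γ₁) (hs0 : 0 < s) (hs : s < 1 / 2) :
    ∃ η C Z : ℝ, 0 < η ∧ η < 1 ∧ 0 < C ∧ 1 ≤ Z ∧ ∀ z, Z ≤ z → ∀ p q m d E : ℝ,
      m = z ^ 4 → p = γ₁ / z ^ 2 → q = γ₂ / z ^ 2 → d = m * (p + q) - p → E = 340 * √(2 * m * p) →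
      p ≤ 1 ∧ 0 < d ∧ η / 2 * (2 * m * p) ≤ η * d ∧
      ∀ μ β ρ : ℝ,
      μ = (1 - 2 * s) * (m * (p + q)) / ((1 + η) * d) -
        ((1 - 2 * s) * p + E) * (1 / ((1 - η) * d)) →
      β = 1 / ((1 - η) * d) * ((1 - 2 * s) * (m * (p + q)) * (E / d) ^ 2 +
        (1 - 2 * s) * (m * (p - q)) + E) →
      ρ = 1 / ((1 - η) * d) * (E + (1 - 2 * s) * (2 * m * p) * (E / d) + (1 - 2 * s) * p) →
      β < μ ∧ 2 * (ρ / (μ - β)) ^ 2 ≤ (C / z) ^ 2 := by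
  have hγ₁ : 0 < γ₁ := hγ₂.trans hγ
  set θ := 1 - 2 * s with hθ
  have hθ0 : 0 < θ := by rw [hθ]; linarith
  have hθ1 : θ ≤ 1 := by rw [hθ]; linarith
  set κ := (γ₁ - γ₂) / (γ₁ + γ₂) with hκ
  have hγs : 0 < γ₁ + γ₂ := by linarith
  have hκ0 : 0 < κ := div_pos (by linarith) hγs
  have hκ1 : κ < 1 := by rw [hκ, div_lt_one hγs]; linarith
  have hκγ : κ * (γ₁ + γ₂) = γ₁ - γ₂ := by rw [hκ]; field_simp
  -- Then `κ = 1 - 4η`, so `κ(1 + η) < 1 - η`, and the limiting gap `G` stays positive although the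
  -- degrees vary by a factor `1 ± η`.
  set η := (1 - κ) / 4 with hη
  have hη0 : 0 < η := by rw [hη]; linarith
  have hη1 : η ≤ 1 / 4 := by rw [hη]; linarith
  set G := θ * (1 / (1 + η) - κ / (1 - η)) with hG
  have hG0 : 0 < G := by
    refine mul_pos hθ0 ?_
    rw [sub_pos, div_lt_div_iff₀ (by linarith) (by linarith)]
    nlinarith
  -- With `mp = γ₁z²` one gets `E = E₀ z`. `B` bounds `(d + p)(E/d)²`, `C₁/z` the loss in the gap,
  -- and `C₂/z` the residual `ρ`.
  set E₀ := 340 * √(2 * γ₁) with hE₀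
  have hE₀0 : 0 < E₀ := by rw [hE₀]; positivity
  set B := 2 * E₀ ^ 2 / γ₁ with hB
  have hB0 : 0 < B := by rw [hB]; positivity
  set C₁ := 2 / γ₁ * (2 + 2 * E₀ + B) with hC₁
  have hC₁0 : 0 < C₁ := by rw [hC₁]; positivity
  set C₂ := 2 / γ₁ * (3 * E₀ + 1) with hC₂
  have hC₂0 : 0 < C₂ := by rw [hC₂]; positivity
  -- In the threshold, `γ₁` ensures `p ≤ 1`, the two reciprocals ensure `d ≥ γ₁z² ≥ 1`, and `2C₁/G`
  -- keeps half of `G` as gap. The constant `4C₂/G` is twice `C₂/(G/2)`, with `√2` rounded up to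
  -- `2`.
  refine ⟨η, 4 * C₂ / G, 1 + γ₁ + 1 / γ₁ + 1 / γ₂ + 2 * C₁ / G, hη0, by linarith, by positivity, ?_,
    ?_⟩
  · have : 0 < γ₁ + 1 / γ₁ + 1 / γ₂ + 2 * C₁ / G := by positivity
    linarith
  clear_value θ κ η G E₀ B C₁ C₂
  intro z hz p q m d E hm hp hq hd hE
  have i1 : 0 < 1 / γ₁ := by positivity
  have i2 : 0 < 1 / γ₂ := by positivity
  have i3 : 0 < 2 * C₁ / G := by positivity
  have hz1 : 1 ≤ z := by linarith
  have hz0 : 0 < z := by linarith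
  have hzz : z ≤ z ^ 2 := by nlinarith
  have hmp : m * p = γ₁ * z ^ 2 := by rw [hm, hp]; field_simp
  have hmq : m * q = γ₂ * z ^ 2 := by rw [hm, hq]; field_simp
  have hp0 : 0 < p := by rw [hp]; positivity
  have hp1 : p ≤ 1 := by rw [hp, div_le_one (by positivity)]; linarith
  have hz2 : 1 ≤ γ₂ * z ^ 2 := by
    have : 1 / γ₂ ≤ z ^ 2 := by linarith
    rwa [div_le_iff₀' hγ₂] at this
  have hz3 : 1 ≤ γ₁ * z ^ 2 := by
    have : 1 / γ₁ ≤ z ^ 2 := by linarith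
    rwa [div_le_iff₀' hγ₁] at this
  have hdp : m * (p + q) = d + p := by rw [hd]; ring
  have hdγ : γ₁ * z ^ 2 ≤ d := by
    have : d = m * p + m * q - p := by rw [hd]; ring
    rw [this, hmp, hmq]; linarith
  have hd1 : 1 ≤ d := by linarith
  have hd0 : 0 < d := by linarith
  have hEz : E = E₀ * z := by
    rw [hE, hE₀, mul_assoc 2, hmp, ← mul_assoc, Real.sqrt_mul (by positivity), Real.sqrt_sq hz0.le]
    ring
  have hE0 : 0 < E := by rw [hEz]; positivity
  refine ⟨hp1, hd0, ?_, ?_⟩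
  · rw [mul_assoc 2, hmp]
    calc η / 2 * (2 * (γ₁ * z ^ 2)) = η * (γ₁ * z ^ 2) := by ring
      _ ≤ η * d := by gcongr
  intro μ β ρ hμ hβ hρ
  set Δ := 1 / ((1 - η) * d) with hΔ
  clear_value Δ
  have hηd : 0 < (1 - η) * d := mul_pos (by linarith) hd0
  have hΔ0 : 0 < Δ := by rw [hΔ]; positivity
  have hΔz : Δ ≤ 2 / γ₁ * (1 / z ^ 2) := by
    rw [hΔ, div_mul_div_comm, mul_one, div_le_div_iff₀ hηd (by positivity)]
    have : 1 / 2 * d ≤ (1 - η) * d := mul_le_mul_of_nonneg_right (by linarith) hd0.le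
    linarith
  have hEd : (d + p) * (E / d) ^ 2 ≤ B := by
    have h1 : (d + p) * (E / d) ^ 2 ≤ 2 * d * (E / d) ^ 2 := by
      gcongr; linarith
    have h2 : 2 * d * (E / d) ^ 2 = 2 * E ^ 2 / d := by field_simp
    have h3 : 2 * E ^ 2 / d ≤ 2 * E ^ 2 / (γ₁ * z ^ 2) := by gcongr
    have h4 : 2 * E ^ 2 / (γ₁ * z ^ 2) = B := by rw [hEz, hB]; field_simp
    linarith
  have hscale : ∀ x y : ℝ, 0 ≤ x → 0 ≤ y → Δ * (x + y * E₀ * z) ≤ 2 / γ₁ * (x + y * E₀) / z := by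
    intro x y hx hy
    calc Δ * (x + y * E₀ * z) ≤ 2 / γ₁ * (1 / z ^ 2) * (x * z + y * E₀ * z) := by
          refine mul_le_mul hΔz ?_ (by positivity) (by positivity)
          have := le_mul_of_one_le_right hx hz1
          linarith
      _ = _ := by field_simp
  have hmq' : m * (p - q) = κ * (d + p) := by
    rw [← hdp, mul_sub, mul_add, hmp, hmq]
    linear_combination (-z ^ 2) * hκγ
  have hgap : G / 2 ≤ μ - β := by
    have h1 : θ / (1 + η) ≤ θ * (m * (p + q)) / ((1 + η) * d) := by
      rw [hdp, div_le_div_iff₀ (by linarith) (by positivity)]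
      have : 0 ≤ θ * (1 + η) * p := by positivity
      linarith
    have h2 : (θ * p + E) * Δ ≤ (1 + E) * Δ := by
      gcongr
      exact mul_le_one₀ hθ1 hp0.le hp1
    have h3 : Δ * (θ * (m * (p + q)) * (E / d) ^ 2) ≤ Δ * B := by
      gcongr
      rw [hdp, mul_assoc]
      exact (mul_le_of_le_one_left (by positivity) hθ1).trans hEd
    have h4 : Δ * (θ * (m * (p - q))) ≤ θ * (κ / (1 - η)) + Δ := by
      have h5 : Δ * (θ * (m * (p - q))) = θ * (κ / (1 - η)) + Δ * (θ * κ * p) := by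
        have : (1 - η) ≠ 0 := by linarith
        rw [hmq', hΔ]
        field_simp
      rw [h5]
      have : θ * κ * p ≤ 1 := mul_le_one₀ (mul_le_one₀ hθ1 hκ0.le hκ1.le) hp0.le hp1
      have := mul_le_of_le_one_right hΔ0.le this
      linarith
    have h6 : Δ * (2 + B + 2 * E₀ * z) ≤ C₁ / z := by
      refine (hscale (2 + B) 2 (by positivity) (by norm_num)).trans (le_of_eq ?_)
      rw [hC₁]; ring
    have h7 : C₁ / z ≤ G / 2 := by
      have : 2 * C₁ / G ≤ z := by linarith
      rw [div_le_iff₀ hG0] at this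
      rw [div_le_div_iff₀ hz0 two_pos]
      linarith
    have h8 : G = θ / (1 + η) - θ * (κ / (1 - η)) := by rw [hG]; ring
    have h9 : β = Δ * (θ * (m * (p + q)) * (E / d) ^ 2) + Δ * (θ * (m * (p - q))) + Δ * E := by
      rw [hβ]; ring
    rw [hμ, h9]
    rw [mul_assoc, ← hEz] at h6
    have h10 : (1 + E) * Δ + Δ * B + Δ + Δ * E = Δ * (2 + B + 2 * E) := by ring
    linarith
  have hgap0 : 0 < μ - β := by linarith
  have hρ0 : 0 ≤ ρ := by
    rw [hρ, mul_assoc 2, hmp]; positivity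
  have hρz : ρ ≤ C₂ / z := by
    have h1 : θ * (2 * m * p) * (E / d) ≤ 2 * E := by
      rw [mul_assoc 2, hmp]
      have h2 : θ * (2 * (γ₁ * z ^ 2)) ≤ 2 * d := by
        have : θ * (2 * (γ₁ * z ^ 2)) ≤ 2 * (γ₁ * z ^ 2) :=
          mul_le_of_le_one_left (by positivity) hθ1
        linarith
      calc _ ≤ 2 * d * (E / d) := by gcongr
        _ = 2 * E := by field_simp
    have h3 : θ * p ≤ 1 := mul_le_one₀ hθ1 hp0.le hp1
    calc ρ ≤ Δ * (1 + 3 * E₀ * z) := by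
          rw [hρ]
          refine mul_le_mul_of_nonneg_left ?_ hΔ0.le
          rw [mul_assoc 3, ← hEz]
          linarith
      _ ≤ 2 / γ₁ * (1 + 3 * E₀) / z := hscale 1 3 zero_le_one (by norm_num)
      _ = C₂ / z := by rw [hC₂]; ring
  refine ⟨by linarith, ?_⟩
  have h1 : ρ / (μ - β) ≤ (C₂ / z) / (G / 2) := by gcongr
  calc 2 * (ρ / (μ - β)) ^ 2 ≤ 2 * ((C₂ / z) / (G / 2)) ^ 2 := by gcongr
    _ ≤ 4 * ((C₂ / z) / (G / 2)) ^ 2 := by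
        have := sq_nonneg ((C₂ / z) / (G / 2))
        linarith
    _ = _ := by field_simp; norm_num

/-- The exponential beats the sixth power of `√k`, which is `k³`: one factor `k` absorbs the number
of nodes and `k²` remains. -/
theorem eventually_failure_le {c : ℝ} (hc : 0 < c) :
    ∀ᶠ k : ℕ in atTop, 14 * (2 * k : ℝ) * Real.exp (-(c * √k)) ≤ ((k : ℝ) ^ 2)⁻¹ := by
  have h1 : Tendsto (fun k : ℕ => c * √(k : ℝ)) atTop atTop :=
    (Real.tendsto_sqrt_atTop.comp tendsto_natCast_atTop_atTop).const_mul_atTop hc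
  have h2 := (Real.tendsto_pow_mul_exp_neg_atTop_nhds_zero 6).comp h1
  have h3 : ∀ᶠ k : ℕ in atTop, (c * √(k : ℝ)) ^ 6 * Real.exp (-(c * √(k : ℝ))) < c ^ 6 / 28 :=
    h2.eventually (gt_mem_nhds (by positivity))
  filter_upwards [h3, eventually_gt_atTop 0] with k hk hk0
  have hk0' : (0 : ℝ) < k := by exact_mod_cast hk0
  have h4 : √(k : ℝ) ^ 6 = (k : ℝ) ^ 3 := by
    rw [show (6 : ℕ) = 2 * 3 by norm_num, pow_mul, Real.sq_sqrt hk0'.le]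
  rw [mul_pow, h4] at hk
  have hc6 : 0 < c ^ 6 := by positivity
  have h5 : (k : ℝ) ^ 3 * Real.exp (-(c * √(k : ℝ))) < 1 / 28 := by
    refine lt_of_mul_lt_mul_left ?_ hc6.le
    linarith
  rw [← one_div, le_div_iff₀ (by positivity)]
  nlinarith

end SignedSBM

/-! ### Eigenvector rate and weak consistency in the dense regime -/

open SignedSBM
theorem corollary4p6 (γ₁ γ₂ s : ℝ) (hγ₂ : 0 < γ₂) (hγ : γ₂ < γ₁) (hs0 : 0 < s) (hs : s < 1 / 2) :
    (∃ C : ℝ, 0 < C ∧ ∃ K : ℕ, ∀ k : ℕ, K ≤ k →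
      1 - ((k : ℝ) ^ 2)⁻¹ ≤ (denseBlock γ₁ γ₂ s k).real
        {ω | LambdaOneSimple (normLaplacian (adjacency ω)) ∧
          (∀ u v : EuclideanSpace ℝ (Fin (2 * k)),
            IsUnitEigenvectorOne (normLaplacian (adjacency ω)) u →
            IsUnitEigenvectorOne (normLaplacian (adjacency ω)) v → v = u ∨ v = -u) ∧
          ∀ u : EuclideanSpace ℝ (Fin (2 * k)),
            IsUnitEigenvectorOne (normLaplacian (adjacency ω)) u →
            ∃ τ : ℝ, (τ = 1 ∨ τ = -1) ∧
              ‖τ • u - uBar k‖ ≤ C * (k : ℝ) ^ (-(1 / 4) : ℝ) ∧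
              (misclassified k (τ • u) : ℝ) ≤ C * (k : ℝ) ^ (1 / 2 : ℝ)}) ∧
    (∀ ε : ℝ, 0 < ε →
      Tendsto (fun k : ℕ => (denseBlock γ₁ γ₂ s k).real
        {ω | ∀ u : EuclideanSpace ℝ (Fin (2 * k)),
          IsUnitEigenvectorOne (normLaplacian (adjacency ω)) u →
          ∃ τ : ℝ, (τ = 1 ∨ τ = -1) ∧
            (misclassified k (τ • u) : ℝ) / (2 * (k : ℝ)) ≤ ε})
        atTop (𝓝 1)) := by
  have hprob : ∀ k, IsProbabilityMeasure (denseBlock γ₁ γ₂ s k) := fun k => by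
    unfold denseBlock signedBlock signedER; infer_instance
  -- Weak consistency follows from the quantitative part: the misclassified fraction is at most
  -- `(C/2) k^{-1/2}`, eventually below `ε`, on events of probability at least `1 - k^{-2}`.
  refine (and_iff_left_of_imp fun hfirst ε hε => ?_).2 ?_
  · obtain ⟨C, hC, K, hK⟩ := hfirst
    have hinv : Tendsto (fun k : ℕ => 1 - ((k : ℝ) ^ 2)⁻¹) atTop (𝓝 1) := by
      have h := (tendsto_inv_atTop_zero.comp ((tendsto_pow_atTop two_ne_zero).comp
        (tendsto_natCast_atTop_atTop (R := ℝ)))).const_sub 1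
      simpa using h
    have hrate : ∀ᶠ k : ℕ in atTop, C / 2 * (k : ℝ) ^ (-(1 / 2) : ℝ) < ε := by
      have h := ((tendsto_rpow_neg_atTop (y := 1 / 2) (by norm_num)).comp
        (tendsto_natCast_atTop_atTop (R := ℝ))).const_mul (C / 2)
      rw [mul_zero] at h
      exact h.eventually (gt_mem_nhds hε)
    refine tendsto_of_tendsto_of_tendsto_of_le_of_le' hinv tendsto_const_nhds ?_
      (Eventually.of_forall fun k => measureReal_le_one)
    filter_upwards [hrate, eventually_ge_atTop K, eventually_gt_atTop 0] with k hk hkK hk0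
    refine (hK k hkK).trans (measureReal_mono ?_)
    rintro ω ⟨-, -, h⟩ u hu
    obtain ⟨τ, hτ, -, hm⟩ := h u hu
    refine ⟨τ, hτ, le_trans ?_ hk.le⟩
    have hk0' : (0 : ℝ) < k := by exact_mod_cast hk0
    rw [div_le_iff₀ (by positivity)]
    refine hm.trans (le_of_eq ?_)
    have : (k : ℝ) ^ (1 / 2 : ℝ) = (k : ℝ) ^ (-(1 / 2) : ℝ) * k := by
      rw [← Real.rpow_add_one hk0'.ne']; norm_num
    rw [this]
    ring
  · have hγ₁ : 0 < γ₁ := hγ₂.trans hγ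
    obtain ⟨η, C, Z, hη0, hη1, hC, hZ, hgap⟩ := dense_gap hγ₂ hγ hs0 hs
    have hfail := eventually_failure_le (c := (η / 2) ^ 2 * (2 * γ₁) / 4) (by positivity)
    have hlarge : ∀ᶠ k : ℕ in atTop, Z ≤ (k : ℝ) ^ (1 / 4 : ℝ) :=
      ((tendsto_rpow_atTop (by norm_num)).comp
        (tendsto_natCast_atTop_atTop (R := ℝ))).eventually_ge_atTop Z
    have hlarge' : ∀ᶠ k : ℕ in atTop, 1 / γ₁ ≤ √(k : ℝ) :=
      (Real.tendsto_sqrt_atTop.comp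
        (tendsto_natCast_atTop_atTop (R := ℝ))).eventually_ge_atTop _
    obtain ⟨K, hK⟩ := eventually_atTop.1
      ((hfail.and (hlarge.and hlarge')).and (eventually_gt_atTop 0))
    -- One constant serves both bounds: the distance is at most `C/z`, and the number of wrong signs
    -- at most `2k(C/z)² = 2C²z²`, where `z = k^{1/4}`.
    refine ⟨C + 2 * C ^ 2, by positivity, K, fun k hk => ?_⟩
    obtain ⟨⟨hkfail, hkZ, hkγ⟩, hk0⟩ := hK k hk
    have hk0' : (0 : ℝ) < k := by exact_mod_cast hk0
    set z := (k : ℝ) ^ (1 / 4 : ℝ) with hz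
    have hz0 : 0 < z := by rw [hz]; positivity
    have hz4 : (k : ℝ) = z ^ 4 := by
      rw [hz, ← Real.rpow_natCast, ← Real.rpow_mul hk0'.le]; norm_num
    have hz2 : (k : ℝ) ^ (1 / 2 : ℝ) = z ^ 2 := by
      rw [hz, ← Real.rpow_natCast, ← Real.rpow_mul hk0'.le]; norm_num
    have hzi : (k : ℝ) ^ (-(1 / 4) : ℝ) = z⁻¹ := by rw [hz, Real.rpow_neg hk0'.le]
    have hzi2 : (k : ℝ) ^ (-(1 / 2) : ℝ) = (z ^ 2)⁻¹ := by rw [Real.rpow_neg hk0'.le, hz2]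
    have hsqrt : √(k : ℝ) = z ^ 2 := by rw [Real.sqrt_eq_rpow, hz2]
    obtain ⟨hp1, hd0, hη', hconc⟩ := hgap z hkZ (γ₁ / z ^ 2) (γ₂ / z ^ 2) k _ _ hz4 rfl rfl rfl rfl
    have hp0 : 0 < γ₁ / z ^ 2 := by positivity
    have hq0 : 0 < γ₂ / z ^ 2 := by positivity
    have hqp : γ₂ / z ^ 2 ≤ γ₁ / z ^ 2 := by gcongr
    obtain ⟨hβμ, hdist⟩ := hconc _ _ _ rfl rfl rfl
    have hpc : (prob (γ₁ / z ^ 2) : ℝ) = γ₁ / z ^ 2 := coe_prob hp0.le hp1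
    have hqc : (prob (γ₂ / z ^ 2) : ℝ) = γ₂ / z ^ 2 := coe_prob hq0.le (hqp.trans hp1)
    have hsc : (prob s : ℝ) = s := coe_prob hs0.le (by linarith)
    have hqp' : prob (γ₂ / z ^ 2) ≤ prob (γ₁ / z ^ 2) := by
      rw [← Subtype.coe_le_coe, hpc, hqc]; exact hqp
    have hmeas : denseBlock γ₁ γ₂ s k = signedER (edgeProb k (prob (γ₁ / z ^ 2))
        (prob (γ₂ / z ^ 2))) (signProb k (prob s)) := by
      rw [denseBlock, hzi2, ← div_eq_mul_inv, ← div_eq_mul_inv]; rfl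
    have hnp : (2 * k : ℕ) * (γ₁ / z ^ 2) = 2 * γ₁ * √(k : ℝ) := by
      push_cast
      rw [hsqrt, hz4]
      field_simp
    have htail := not_isTypical_le (edgeProb k (prob (γ₁ / z ^ 2)) (prob (γ₂ / z ^ 2)))
      (signProb k (prob s)) (p := γ₁ / z ^ 2) (η := η / 2) hp0 hp1
      (by
        rw [hnp]
        rw [div_le_iff₀' hγ₁] at hkγ
        linarith)
      (by linarith) (by linarith) (fun i j => (edgeProb_le hqp' i j).trans hpc.le)
    rw [← hmeas] at htail
    have hsmall : (denseBlock γ₁ γ₂ s k).real {ω | ¬ IsTypical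
        (edgeProb k (prob (γ₁ / z ^ 2)) (prob (γ₂ / z ^ 2))) (signProb k (prob s))
        (γ₁ / z ^ 2) (η / 2) ω} ≤ ((k : ℝ) ^ 2)⁻¹ := by
      refine htail.trans (le_trans (le_of_eq ?_) hkfail)
      rw [hnp]
      push_cast
      congr 2
      ring
    have hcompl := probReal_compl_eq_one_sub (μ := denseBlock γ₁ γ₂ s k)
      (s := {ω | ¬ IsTypical (edgeProb k (prob (γ₁ / z ^ 2)) (prob (γ₂ / z ^ 2)))
        (signProb k (prob s)) (γ₁ / z ^ 2) (η / 2) ω}) (Set.toFinite _).measurableSet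
    refine le_trans (by rw [hcompl]; linarith) (measureReal_mono (μ := denseBlock γ₁ γ₂ s k)
      (s₁ := {ω | ¬ IsTypical (edgeProb k (prob (γ₁ / z ^ 2)) (prob (γ₂ / z ^ 2)))
        (signProb k (prob s)) (γ₁ / z ^ 2) (η / 2) ω}ᶜ) fun ω hω => ?_)
    have hω' : IsTypical (edgeProb k (prob (γ₁ / z ^ 2)) (prob (γ₂ / z ^ 2)))
        (signProb k (prob s)) (prob (γ₁ / z ^ 2)) (η / 2) ω := by
      rw [hpc]
      exact not_not.1 hω
    obtain ⟨h1, h2, h3⟩ := IsTypical.eigenvector_bound hk0 hqp' (by rw [hsc]; exact hs.le)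
      (η := η) rfl (by rw [hpc, hqc]; exact hd0) hη1 (by rw [hpc, hqc]; exact hη') rfl hω'
      rfl rfl rfl (by rw [hpc, hqc, hsc]; exact hβμ)
    rw [hpc, hqc, hsc] at h3
    refine ⟨h1, h2, fun u hu => ?_⟩
    obtain ⟨τ, hτ, hτu⟩ := h3 u hu
    have hle := hτu.trans hdist
    refine ⟨τ, hτ, ?_, ?_⟩
    · rw [hzi]
      have := (sq_le_sq₀ (norm_nonneg _) (by positivity)).1 hle
      refine this.trans ?_
      rw [div_eq_mul_inv]
      gcongr
      have := sq_nonneg C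
      linarith
    · rw [hz2]
      refine (misclassified_le _).trans ?_
      calc 2 * (k : ℝ) * ‖τ • u - uBar k‖ ^ 2 ≤ 2 * k * (C / z) ^ 2 := by gcongr
        _ = 2 * C ^ 2 * z ^ 2 := by rw [hz4]; field_simp
        _ ≤ (C + 2 * C ^ 2) * z ^ 2 := by
            gcongr
            linarith
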